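/- Let $\Omega\subset\mathbb{R}^3$ be a bounded, connected, open set with smooth boundary $\partial\Omega$, with outward unit normal $\boldsymbol n$, surface measure $\mathrm dS$ (the two-dimensional Hausdorff measure on $\partial\Omega$) and shape operator $d\boldsymbol n_p:T_p(\partial\Omega)\to T_p(\partial\Omega)$, the differential of the Gauss map $\boldsymbol n:\partial\Omega\to S^2$. Let $\alpha\in C^0(\partial\Omega)$ be real-valued. Let $H^1_{\sigma,\mathrm{tan}}(\Omega)$ be the space of vector fields $u\in L^2(\Omega;\mathbb{R}^3)$ with square-integrable first-order weak derivatives, with $\operatorname{div}u=0$ in $\Omega$ and with vanishing normal trace $u\cdot\boldsymbol n=0$ on $\partial\Omega$, and let $C^\infty_{\sigma,\mathrm{tan}}(\overline\Omega)$ be the space of vector fields, smooth up to the boundary, that are divergence-free in $\Omega$ and tangent to $\partial\Omega$. For a vector field $v$ write $(Dv)_{ij}=\partial_jv_i$ and $Sv=\tfrac12\big(Dv+(Dv)^t\big)$, and for matrices write $A:B=\sum_{i,j}A_{ij}B_{ij}$. Then, for every $u\in H^1_{\sigma,\mathrm{tan}}(\Omega)$ and every $\Phi\in C^\infty_{\sigma,\mathrm{tan}}(\overline\Omega)$,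 $$\int_\Omega D\Phi:Du\,\mathrm dx+\int_{\partial\Omega}\Phi\cdot[\alpha u-d\boldsymbol n(u)]\,\mathrm dS=2\int_\Omega S\Phi:Su\,\mathrm dx+\int_{\partial\Omega}\alpha\,\Phi\cdot u\,\mathrm dS,$$ where $u$ on $\partial\Omega$ is understood in the sense of traces. -/

import Mathlib

open MeasureTheory Filter Topology
open scoped ContDiff

noncomputable section

namespace NavierFriction

/-- Three-dimensional Euclidean space. -/
abbrev E3 : Type := EuclideanSpace ℝ (Fin 3)

/-! ### The domain and the geometry of its boundary -/

/-- `ρ` is a smooth function which, near `p`, is negative exactly on `Ω`, and whose differential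
at `p` is nonzero. -/
def IsLocalDefiningFunction (Ω : Set E3) (p : E3) (ρ : E3 → ℝ) : Prop :=
  ContDiff ℝ ∞ ρ ∧ fderiv ℝ ρ p ≠ 0 ∧ ∀ᶠ x in 𝓝 p, (x ∈ Ω ↔ ρ x < 0)

/-- A bounded, connected, open set with smooth boundary. -/
structure IsSmoothBoundedDomain (Ω : Set E3) : Prop where
  isOpen : IsOpen Ω
  isConnected : IsConnected Ω
  isBounded : Bornology.IsBounded Ω
  smooth_boundary : ∀ p ∈ frontier Ω, ∃ ρ : E3 → ℝ, IsLocalDefiningFunction Ω p ρ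

open Classical in
/-- The outward unit normal at `p ∈ ∂Ω`: the normalized gradient of a local defining function
(the value does not depend on which one is used). The value away from `∂Ω` is irrelevant. -/
def outwardNormal (Ω : Set E3) (p : E3) : E3 :=
  if h : ∃ ρ : E3 → ℝ, IsLocalDefiningFunction Ω p ρ then
    ‖gradient h.choose p‖⁻¹ • gradient h.choose p
  else 0

/-- Orthogonal projection of `v` onto the tangent plane `T_p(∂Ω)`. -/
def tangentialPart (Ω : Set E3) (p v : E3) : E3 :=
  v - inner ℝ v (outwardNormal Ω p) • outwardNormal Ω p

/-- The shape operator: the differential at `p` of the Gauss map `∂Ω → S²`, applied to (the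
tangential part of) `v`. A derivative within `∂Ω` is uniquely determined on tangent vectors, and
only its values on tangent vectors are used. -/
def shapeOperator (Ω : Set E3) (p v : E3) : E3 :=
  fderivWithin ℝ (outwardNormal Ω) (frontier Ω) p (tangentialPart Ω p v)

/-- Surface measure on `∂Ω`: the two-dimensional Hausdorff measure, normalized so as to agree
with Lebesgue area on planes. -/
def surfaceMeasure (Ω : Set E3) : Measure E3 :=
  (μHE[2] : Measure E3).restrict (frontier Ω)

/-! ### Jacobians -/

/-- The classical Jacobian matrix, `(Dv)_{ij} = ∂_j v_i`. -/
def jacobian (v : E3 → E3) (x : E3) : Matrix (Fin 3) (Fin 3) ℝ :=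
  Matrix.of fun i j => (fderiv ℝ v x (EuclideanSpace.single j 1)) i

/-- The Frobenius product `A : B = ∑ i j, A i j * B i j`. -/
def frobenius (A B : Matrix (Fin 3) (Fin 3) ℝ) : ℝ :=
  ∑ i, ∑ j, A i j * B i j

/-- The symmetric part `(A + Aᵗ) / 2`. -/
def symPart (A : Matrix (Fin 3) (Fin 3) ℝ) : Matrix (Fin 3) (Fin 3) ℝ :=
  (1 / 2 : ℝ) • (A + A.transpose)

/-- `G` is a weak Jacobian of `u` on `Ω` with square-integrable entries. -/
def IsWeakJacobian (Ω : Set E3) (u : E3 → E3) (G : E3 → Matrix (Fin 3) (Fin 3) ℝ) : Prop :=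
  (∀ i j, MemLp (fun x => G x i j) 2 (volume.restrict Ω)) ∧
  ∀ φ : E3 → ℝ, ContDiff ℝ ∞ φ → HasCompactSupport φ → tsupport φ ⊆ Ω → ∀ i j,
    ∫ x in Ω, u x i * fderiv ℝ φ x (EuclideanSpace.single j 1) = - ∫ x in Ω, G x i j * φ x

/-- The Sobolev space `H¹(Ω)` of vector fields. -/
def MemH1 (Ω : Set E3) (u : E3 → E3) : Prop :=
  MemLp u 2 (volume.restrict Ω) ∧ ∃ G, IsWeakJacobian Ω u G

open Classical in
/-- The weak Jacobian `Du` of `u ∈ H¹(Ω)`, unique up to null sets. -/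
def weakJacobian (Ω : Set E3) (u : E3 → E3) : E3 → Matrix (Fin 3) (Fin 3) ℝ :=
  if h : ∃ G, IsWeakJacobian Ω u G then h.choose else 0

/-! ### The trace -/

/-- `g ∈ L²(∂Ω)` is the trace of `u ∈ H¹(Ω)`: there are fields `v k`, smooth up to the boundary,
with `v k → u` in `H¹(Ω)` and `v k → g` in `L²(∂Ω)`. -/
def IsTrace (Ω : Set E3) (u g : E3 → E3) : Prop :=
  MemLp g 2 (surfaceMeasure Ω) ∧
  ∃ v : ℕ → E3 → E3, (∀ k, ContDiff ℝ ∞ (v k)) ∧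
    Tendsto (fun k => eLpNorm (v k - u) 2 (volume.restrict Ω)) atTop (𝓝 0) ∧
    (∀ i j, Tendsto
      (fun k => eLpNorm (fun x => jacobian (v k) x i j - weakJacobian Ω u x i j) 2
        (volume.restrict Ω)) atTop (𝓝 0)) ∧
    Tendsto (fun k => eLpNorm (v k - g) 2 (surfaceMeasure Ω)) atTop (𝓝 0)

open Classical in
/-- The boundary trace of `u ∈ H¹(Ω)`, unique up to null sets of the surface measure. -/
def boundaryTrace (Ω : Set E3) (u : E3 → E3) : E3 → E3 :=
  if h : ∃ g, IsTrace Ω u g then h.choose else 0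

/-! ### Spaces of solenoidal fields tangent to the boundary -/

/-- `L²_{σ,tan}(Ω)`: square-integrable fields with vanishing weak divergence, and vanishing normal
trace. The normal trace of an `L²` field with `div u = 0` is the functional
`φ ↦ ∫_Ω u · ∇φ` of the boundary values of `φ`, for `φ` smooth up to the boundary. -/
structure MemL2SigmaTan (Ω : Set E3) (u : E3 → E3) : Prop where
  memLp : MemLp u 2 (volume.restrict Ω)
  solenoidal : ∀ φ : E3 → ℝ, ContDiff ℝ ∞ φ → HasCompactSupport φ → tsupport φ ⊆ Ω →
    ∫ x in Ω, inner ℝ (u x) (gradient φ x) = 0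
  tangent : ∀ φ : E3 → ℝ, ContDiff ℝ ∞ φ → ∫ x in Ω, inner ℝ (u x) (gradient φ x) = 0

/-- `H¹_{σ,tan}(Ω)`. -/
def MemH1SigmaTan (Ω : Set E3) (u : E3 → E3) : Prop :=
  MemL2SigmaTan Ω u ∧ MemH1 Ω u

/-- `C^∞_{σ,tan}(closure Ω)`: fields which are smooth up to the boundary (restrictions of smooth
fields on the whole space), divergence-free, and tangent to `∂Ω`. -/
structure MemSmoothSigmaTan (Ω : Set E3) (Φ : E3 → E3) : Prop where
  smooth : ∃ Ψ : E3 → E3, ContDiff ℝ ∞ Ψ ∧ Set.EqOn Φ Ψ (closure Ω)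
  solenoidal : ∀ x ∈ Ω, (jacobian Φ x).trace = 0
  tangent : ∀ p ∈ frontier Ω, inner ℝ (Φ p) (outwardNormal Ω p) = 0

end NavierFriction

end

open NavierFriction

open MeasureTheory Filter Topology
open scoped ContDiff

noncomputable section

namespace NavierFriction

section

variable {Ω : Set E3} {p : E3} {ρ : E3 → ℝ}

/-! ### Local defining functions and the outward normal -/

/-! Algebraically, `2 SΦ : Su = DΦ : Du + (DΦ)ᵗ : Du` (`two_mul_frobenius_symPart`), so everything
reduces to showing that the integral of `(DΦ)ᵗ : Du` over `Ω` equals minus the boundary integral of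
`Φ · dn(u)`.

Integrating `∂ᵢΦⱼ ∂ⱼuᵢ` by parts in `xⱼ` produces the boundary term `(DΦ u) · n` and the volume term
`∂ᵢ(div Φ) uᵢ`, which vanishes (`IsTrace.integral_transpose_jacobian`). On the boundary `Φ · n = 0`;
differentiating this along the tangent vector `u` gives `(DΦ u) · n = -Φ · dn(u)`
(`IsSmoothBoundedDomain.inner_shapeOperator`). That `u` is tangent almost everywhere follows from
Green's formula and the vanishing weak normal trace (`MemH1SigmaTan.ae_inner_trace`).

The analytic foundations are built along the way. The divergence theorem
(`IsSmoothBoundedDomain.integral_fderiv`) is local: write the domain as a subgraph, integrate along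
lines by the fundamental theorem of calculus, and convert planar area into Hausdorff measure with an
area formula for graphs (`IsSmoothBoundedDomain.map_graph`). Traces exist because smooth functions
are dense in `H¹(Ω)` (`IsWeakGradient.exists_approx`, mollification with kernels shifted into the
domain) and the `L²` boundary norm is bounded by the `H¹` norm
(`IsSmoothBoundedDomain.exists_trace_inequality`). Green's formula then passes from smooth fields to
`H¹` fields by approximation. -/

theorem IsLocalDefiningFunction.gradient_ne_zero (h : IsLocalDefiningFunction Ω p ρ) :
    gradient ρ p ≠ 0 := by
  intro h0
  apply h.2.1
  have : (InnerProductSpace.toDual ℝ E3).symm (fderiv ℝ ρ p) = 0 := h0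
  simpa using this

theorem fderiv_apply_eq_inner_gradient (f : E3 → ℝ) (x v : E3) :
    fderiv ℝ f x v = inner ℝ (gradient f x) v := by
  simp [gradient]

theorem gradient_contDiff {f : E3 → ℝ} (hf : ContDiff ℝ ∞ f) : ContDiff ℝ ∞ (gradient f) :=
  (InnerProductSpace.toDual ℝ E3).symm.contDiff.comp (hf.fderiv_right (m := ∞) (by simp))

theorem IsLocalDefiningFunction.eq_zero (h : IsLocalDefiningFunction Ω p ρ) (hΩ : IsOpen Ω)
    (hp : p ∈ frontier Ω) : ρ p = 0 := by
  have hc : Continuous ρ := h.1.continuous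
  have hpΩ : p ∉ Ω := fun hm => by
    rw [hΩ.frontier_eq] at hp; exact hp.2 hm
  apply le_antisymm _ (not_lt.1 fun hlt => hpΩ (h.2.2.self_of_nhds.2 hlt))
  by_contra! hlt
  have h1 : ∀ᶠ x in 𝓝 p, 0 < ρ x := hc.continuousAt.eventually (lt_mem_nhds hlt)
  have h2 : ∀ᶠ x in 𝓝 p, x ∉ Ω := by
    filter_upwards [h1, h.2.2] with x hx hx' hm
    exact absurd (hx'.1 hm) hx.not_gt
  have h3 := mem_closure_iff_frequently.1 hp.1
  exact h3 h2

theorem IsLocalDefiningFunction.eventually (h : IsLocalDefiningFunction Ω p ρ) :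
    ∀ᶠ q in 𝓝 p, IsLocalDefiningFunction Ω q ρ := by
  have hc : Continuous (fderiv ℝ ρ) := h.1.continuous_fderiv (by simp)
  filter_upwards [h.2.2.eventually_nhds, hc.continuousAt.eventually_ne h.2.1] with q h1 h2
  exact ⟨h.1, h2, h1⟩

/-- Moving from `p` a short way along `v` makes `ρ` negative, hence enters `Ω`, hence makes `σ`
negative; so the one-sided difference quotients of `σ` are negative. This is what forces two
defining functions to have parallel gradients. -/
theorem IsLocalDefiningFunction.fderiv_nonpos {σ : E3 → ℝ} (h : IsLocalDefiningFunction Ω p ρ)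
    (h' : IsLocalDefiningFunction Ω p σ) (hρ : ρ p = 0) (hσ : σ p = 0) {v : E3}
    (hv : fderiv ℝ ρ p v < 0) : fderiv ℝ σ p v ≤ 0 := by
  have hl : HasDerivAt (fun s : ℝ => p + s • v) v 0 := by
    simpa using ((hasDerivAt_id (0 : ℝ)).smul_const v).const_add p
  have hd : ∀ τ : E3 → ℝ, ContDiff ℝ ∞ τ →
      HasDerivAt (fun s : ℝ => τ (p + s • v)) (fderiv ℝ τ p v) 0 := by
    intro τ hτ
    have : HasFDerivAt τ (fderiv ℝ τ p) (p + (0 : ℝ) • v) := by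
      simpa using (hτ.differentiable (by simp) p).hasFDerivAt
    exact this.comp_hasDerivAt 0 hl
  have hr := hd ρ h.1
  have hs := hd σ h'.1
  have hle : 𝓝[>] (0 : ℝ) ≤ 𝓝[≠] 0 := nhdsWithin_mono 0 fun x hx => (Set.mem_Ioi.1 hx).ne'
  have hslope := (hasDerivAt_iff_tendsto_slope.1 hr).mono_left hle
  have hslope' := (hasDerivAt_iff_tendsto_slope.1 hs).mono_left hle
  have hcont : Tendsto (fun s : ℝ => p + s • v) (𝓝[>] 0) (𝓝 p) := by
    have : Tendsto (fun s : ℝ => p + s • v) (𝓝 0) (𝓝 (p + (0 : ℝ) • v)) := hl.continuousAt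
    simp only [zero_smul, add_zero] at this
    exact this.mono_left nhdsWithin_le_nhds
  refine le_of_tendsto hslope' ?_
  filter_upwards [hslope.eventually (gt_mem_nhds hv), hcont.eventually h.2.2,
    hcont.eventually h'.2.2, self_mem_nhdsWithin] with s h1 h2 h3 (hs0 : 0 < s)
  simp only [slope_def_field, zero_smul, add_zero, hρ, hσ, sub_zero] at h1 ⊢
  have : ρ (p + s • v) < 0 := by
    by_contra! hcon
    exact absurd (div_nonneg hcon hs0.le) h1.not_ge
  exact (div_neg_of_neg_of_pos (h3.1 (h2.2 this)) hs0).le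

/-- Frees the normal from the choice in its definition. If the unit gradients `a'`, `b'` differed,
then along `b' - a'` the function `σ` would strictly decrease while `ρ` strictly increased,
contradicting `fderiv_nonpos`. -/
theorem IsLocalDefiningFunction.outwardNormal_eq (h : IsLocalDefiningFunction Ω p ρ)
    (hΩ : IsOpen Ω) (hp : p ∈ frontier Ω) :
    outwardNormal Ω p = ‖gradient ρ p‖⁻¹ • gradient ρ p := by
  have hex : ∃ σ : E3 → ℝ, IsLocalDefiningFunction Ω p σ := ⟨ρ, h⟩
  have h' := hex.choose_spec
  rw [outwardNormal, dif_pos hex]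
  set σ := hex.choose
  have ha := h'.gradient_ne_zero
  have hb := h.gradient_ne_zero
  set a := gradient σ p with hadef
  set b := gradient ρ p with hbdef
  have hna : ‖‖a‖⁻¹ • a‖ = 1 := by
    rw [norm_smul, norm_inv, norm_norm, inv_mul_cancel₀ (norm_ne_zero_iff.2 ha)]
  have hnb : ‖‖b‖⁻¹ • b‖ = 1 := by
    rw [norm_smul, norm_inv, norm_norm, inv_mul_cancel₀ (norm_ne_zero_iff.2 hb)]
  set a' := ‖a‖⁻¹ • a with ha'
  set b' := ‖b‖⁻¹ • b with hb'
  by_contra hne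
  have hlt : inner ℝ a' b' < 1 := by
    refine lt_of_le_of_ne (by simpa [hna, hnb] using real_inner_le_norm a' b') fun he => hne ?_
    exact (inner_eq_one_iff_of_norm_eq_one hna hnb).1 he
  have haa : a = ‖a‖ • a' := by rw [ha', smul_smul, mul_inv_cancel₀ (norm_ne_zero_iff.2 ha), one_smul]
  have hbb : b = ‖b‖ • b' := by rw [hb', smul_smul, mul_inv_cancel₀ (norm_ne_zero_iff.2 hb), one_smul]
  have h1 : fderiv ℝ σ p (b' - a') < 0 := by
    rw [fderiv_apply_eq_inner_gradient, ← hadef, haa, inner_smul_left, inner_sub_right,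
      real_inner_self_eq_norm_sq, hna]
    exact mul_neg_of_pos_of_neg (norm_pos_iff.2 ha) (by linarith)
  have h2 := h'.fderiv_nonpos h (h'.eq_zero hΩ hp) (h.eq_zero hΩ hp) h1
  rw [fderiv_apply_eq_inner_gradient, ← hbdef, hbb, inner_smul_left, inner_sub_right,
      real_inner_self_eq_norm_sq, hnb, real_inner_comm] at h2
  have := mul_pos (norm_pos_iff.2 hb) (by linarith : (0 : ℝ) < 1 ^ 2 - inner ℝ a' b')
  exact absurd h2 (not_le.2 this)

theorem IsSmoothBoundedDomain.norm_outwardNormal (hΩ : IsSmoothBoundedDomain Ω)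
    (hp : p ∈ frontier Ω) : ‖outwardNormal Ω p‖ = 1 := by
  obtain ⟨ρ, h⟩ := hΩ.smooth_boundary p hp
  rw [h.outwardNormal_eq hΩ.isOpen hp, norm_smul, norm_inv, norm_norm,
    inv_mul_cancel₀ (norm_ne_zero_iff.2 h.gradient_ne_zero)]

/-- One defining function serves all boundary points near `p`, so there the normal agrees with a
smooth normalized gradient. Agreement holds only on the boundary, hence the derivative within
`frontier Ω`. -/
theorem IsSmoothBoundedDomain.differentiableWithinAt_outwardNormal
    (hΩ : IsSmoothBoundedDomain Ω) (hp : p ∈ frontier Ω) :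
    DifferentiableWithinAt ℝ (outwardNormal Ω) (frontier Ω) p := by
  obtain ⟨ρ, h⟩ := hΩ.smooth_boundary p hp
  have hd : DifferentiableAt ℝ (fun q => ‖gradient ρ q‖⁻¹ • gradient ρ q) p := by
    have hg : DifferentiableAt ℝ (gradient ρ) p :=
      (gradient_contDiff h.1).differentiable (by simp) p
    exact ((hg.norm ℝ h.gradient_ne_zero).inv (norm_ne_zero_iff.2 h.gradient_ne_zero)).smul hg
  refine hd.differentiableWithinAt.congr_of_eventuallyEq ?_ (h.outwardNormal_eq hΩ.isOpen hp)
  filter_upwards [nhdsWithin_le_nhds h.eventually, self_mem_nhdsWithin] with q hq hq'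
  exact hq.outwardNormal_eq hΩ.isOpen hq'

theorem IsSmoothBoundedDomain.continuousOn_outwardNormal (hΩ : IsSmoothBoundedDomain Ω) :
    ContinuousOn (outwardNormal Ω) (frontier Ω) :=
  fun _ hp => (hΩ.differentiableWithinAt_outwardNormal hp).continuousWithinAt

/-- Near a boundary point, `Ω` is a sublevel set of a function which is almost affine, with slope
the outward unit normal. -/
theorem IsSmoothBoundedDomain.exists_almost_affine (hΩ : IsSmoothBoundedDomain Ω)
    (hp : p ∈ frontier Ω) {ε : ℝ} (hε : 0 < ε) (hε1 : ε < 1) :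
    ∃ ρ : E3 → ℝ, Continuous ρ ∧ ρ p = 0 ∧ ∃ r > 0,
      (∀ x ∈ Metric.ball p r, x ∈ Ω ↔ ρ x < 0) ∧
      (∀ x ∈ Metric.ball p r, x ∈ frontier Ω ↔ ρ x = 0) ∧
      ∀ x ∈ Metric.ball p r, ∀ y ∈ Metric.ball p r,
        |ρ x - ρ y - inner ℝ (outwardNormal Ω p) (x - y)| ≤ ε * ‖x - y‖ := by
  obtain ⟨σ, h⟩ := hΩ.smooth_boundary p hp
  have hg := h.gradient_ne_zero
  have hg' : 0 < ‖gradient σ p‖ := norm_pos_iff.2 hg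
  set c := ‖gradient σ p‖⁻¹ with hc
  have hcpos : 0 < c := inv_pos.2 hg'
  have hn := h.outwardNormal_eq hΩ.isOpen hp
  -- Strict differentiability compares two arbitrary nearby points, not only points with `p`;
  -- scaling by `c` makes the slope the unit normal.
  have hstrict : HasStrictFDerivAt (fun x => c * σ x) (c • fderiv ℝ σ p) p :=
    ((h.1.contDiffAt.hasStrictFDerivAt (by simp)).const_mul c)
  have hev := hstrict.isLittleO.def hε
  rw [← eventually_eventually_nhds] at hev
  have hev' := hev.self_of_nhds
  obtain ⟨s, hs, t, ht, hst⟩ : ∃ s ∈ 𝓝 p, ∃ t ∈ 𝓝 p, ∀ x ∈ s, ∀ y ∈ t,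
      ‖c * σ x - c * σ y - (c • fderiv ℝ σ p) (x - y)‖ ≤ ε * ‖x - y‖ := by
    rw [nhds_prod_eq] at hev'
    obtain ⟨s, hs, t, ht, hst⟩ := mem_prod_iff.1 hev'
    exact ⟨s, hs, t, ht, fun x hx y hy => hst (Set.mk_mem_prod hx hy)⟩
  obtain ⟨r, hr, hball⟩ := Metric.mem_nhds_iff.1
    (inter_mem (inter_mem hs ht) (h.2.2 : {x | x ∈ Ω ↔ σ x < 0} ∈ 𝓝 p))
  have hest : ∀ x ∈ Metric.ball p r, ∀ y ∈ Metric.ball p r,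
      |c * σ x - c * σ y - inner ℝ (outwardNormal Ω p) (x - y)| ≤ ε * ‖x - y‖ := by
    intro x hx y hy
    have := hst x (hball hx).1.1 y (hball hy).1.2
    rw [Real.norm_eq_abs, smul_apply, smul_eq_mul,
      fderiv_apply_eq_inner_gradient] at this
    rwa [hn, inner_smul_left]
  have hΩi : ∀ x ∈ Metric.ball p r, x ∈ Ω ↔ c * σ x < 0 := by
    intro x hx
    refine (hball hx).2.trans ?_
    constructor
    · intro h0; exact mul_neg_of_pos_of_neg hcpos h0
    · intro h0; by_contra! h1
      exact absurd h0 (not_lt.2 (mul_nonneg hcpos.le h1))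
  have hcont : Continuous fun x => c * σ x := continuous_const.mul h.1.continuous
  refine ⟨fun x => c * σ x, hcont, by simp [h.eq_zero hΩ.isOpen hp], r, hr, hΩi, ?_, hest⟩
  intro x hx
  have hxn : Metric.ball p r ∈ 𝓝 x := Metric.isOpen_ball.mem_nhds hx
  constructor
  · intro hxf
    have hxΩ : x ∉ Ω := by rw [hΩ.isOpen.frontier_eq] at hxf; exact hxf.2
    apply le_antisymm _ (not_lt.1 fun h0 => hxΩ ((hΩi x hx).2 h0))
    by_contra! h0
    have h1 : ∀ᶠ y in 𝓝 x, 0 < c * σ y := hcont.continuousAt.eventually (lt_mem_nhds h0)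
    refine mem_closure_iff_frequently.1 hxf.1 ?_
    filter_upwards [h1, hxn] with y hy hy' hm
    exact absurd ((hΩi y hy').1 hm) hy.not_gt
  · intro h0
    rw [hΩ.isOpen.frontier_eq]
    refine ⟨?_, fun hm => by have := (hΩi x hx).1 hm; linarith [h0]⟩
    -- A zero of the rescaled function is approached from inside along `-n`: its value at `x - s n`
    -- is at most `-s + ε s`, negative because `ε < 1`.
    have ht : Tendsto (fun s : ℝ => x - s • outwardNormal Ω p) (𝓝[>] 0) (𝓝 x) := by
      have : Continuous fun s : ℝ => x - s • outwardNormal Ω p := by fun_prop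
      simpa using (this.tendsto 0).mono_left nhdsWithin_le_nhds
    refine mem_closure_of_tendsto ht ?_
    filter_upwards [ht.eventually hxn, self_mem_nhdsWithin] with s hs (hs0 : 0 < s)
    rw [hΩi _ hs]
    have := hest _ hs x hx
    have hnn := hΩ.norm_outwardNormal hp
    simp only [sub_sub_cancel_left, norm_neg, norm_smul, inner_neg_right, inner_smul_right,
      real_inner_self_eq_norm_sq, hnn, Real.norm_eq_abs, abs_of_pos hs0] at this
    have h2 := (abs_le.1 this).2
    simp only at h0
    nlinarith

/-- The point `p + s v` misses the boundary by only `o(s)`, so a normal correction `t n` with `t =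
o(s)` puts it back. The correction is found by the intermediate value theorem, and rescaling by
`s⁻¹` gives vectors converging to `v`. -/
theorem IsSmoothBoundedDomain.mem_tangentConeAt (hΩ : IsSmoothBoundedDomain Ω)
    (hp : p ∈ frontier Ω) {v : E3} (hv : inner ℝ (outwardNormal Ω p) v = 0) :
    v ∈ tangentConeAt ℝ (frontier Ω) p := by
  set n := outwardNormal Ω p with hn
  have hnn : ‖n‖ = 1 := hΩ.norm_outwardNormal hp
  have key : ∀ k : ℕ, ∃ s t : ℝ, 0 < s ∧ s ≤ 1 / (k + 1) ∧ |t| ≤ s * (1 / (k + 1)) ∧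
      p + (s • v + t • n) ∈ frontier Ω := by
    intro k
    set δ : ℝ := 1 / (k + 1) with hδ
    have hδ0 : 0 < δ := by positivity
    have hδ1 : δ ≤ 1 := by rw [hδ, div_le_one (by positivity)]; linarith [Nat.cast_nonneg (α := ℝ) k]
    have hV : 0 < ‖v‖ + 1 := by positivity
    -- With this slope error, `ρ (p + s v + t n)` differs from `t` by at most `s δ / 2` when `t = ±
    -- s δ`, so it changes sign between these two values.
    set ε := δ / (4 * (‖v‖ + 1)) with hε
    have hε0 : 0 < ε := by positivity
    have hεV : ε * (‖v‖ + 1) = δ / 4 := by rw [hε]; field_simp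
    have hε1 : ε ≤ 1 / 4 := by nlinarith [norm_nonneg v]
    obtain ⟨ρ, hρc, hρp, r, hr, -, hfr, hest⟩ := hΩ.exists_almost_affine hp hε0 (by linarith)
    set s := min δ (r / (2 * (‖v‖ + 1))) with hs
    have hs0 : 0 < s := lt_min hδ0 (by positivity)
    have hsr : s * (‖v‖ + 1) ≤ r / 2 := by
      have : s ≤ r / (2 * (‖v‖ + 1)) := min_le_right _ _
      calc s * (‖v‖ + 1) ≤ r / (2 * (‖v‖ + 1)) * (‖v‖ + 1) := by gcongr
        _ = r / 2 := by field_simp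
    have hnorm : ∀ t : ℝ, |t| ≤ s * δ → ‖s • v + t • n‖ ≤ s * ‖v‖ + |t| := by
      intro t _
      refine (norm_add_le _ _).trans_eq ?_
      simp [norm_smul, hnn, abs_of_pos hs0]
    have hmem : ∀ t : ℝ, |t| ≤ s * δ → p + (s • v + t • n) ∈ Metric.ball p r := by
      intro t ht
      rw [Metric.mem_ball, dist_eq_norm, add_sub_cancel_left]
      have := hnorm t ht
      nlinarith
    have hρt : ∀ t : ℝ, |t| ≤ s * δ →
        |ρ (p + (s • v + t • n)) - t| ≤ ε * (s * ‖v‖ + |t|) := by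
      intro t ht
      have h1 := hest _ (hmem t ht) p (Metric.mem_ball_self hr)
      rw [hρp, sub_zero, add_sub_cancel_left, inner_add_right, inner_smul_right, inner_smul_right,
        hv, real_inner_self_eq_norm_sq, hnn] at h1
      simp only [mul_zero, zero_add, one_pow, mul_one] at h1
      exact h1.trans (by gcongr; exact hnorm t ht)
    have hsd : 0 < s * δ := by positivity
    have hpos := abs_le.1 (hρt (s * δ) (abs_of_pos hsd).le)
    have hneg := abs_le.1 (hρt (-(s * δ)) (by rw [abs_neg, abs_of_pos hsd]))
    rw [abs_of_pos hsd] at hpos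
    rw [abs_neg, abs_of_pos hsd] at hneg
    have hb : ε * (s * ‖v‖ + s * δ) ≤ s * δ / 2 := by
      have : ε * (s * ‖v‖ + s * δ) ≤ s * (ε * (‖v‖ + 1)) := by nlinarith [mul_pos hε0 hs0]
      rw [hεV] at this
      nlinarith
    have hcont : ContinuousOn (fun t : ℝ => ρ (p + (s • v + t • n))) (Set.Icc (-(s * δ)) (s * δ)) := by
      fun_prop
    obtain ⟨t, ht, ht0⟩ := intermediate_value_Icc (by linarith) hcont
      (show (0 : ℝ) ∈ Set.Icc _ _ from ⟨by linarith, by linarith⟩)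
    have htabs : |t| ≤ s * δ := abs_le.2 ht
    exact ⟨s, t, hs0, min_le_left _ _, htabs, (hfr _ (hmem t htabs)).2 ht0⟩
  choose s t hs0 hs1 ht hmem using key
  have hlim : Tendsto (fun k : ℕ => (1 : ℝ) / (k + 1)) atTop (𝓝 0) :=
    tendsto_one_div_add_atTop_nhds_zero_nat
  have hs : Tendsto s atTop (𝓝 0) := squeeze_zero (fun k => (hs0 k).le) hs1 hlim
  have hts : Tendsto (fun k => (s k)⁻¹ * t k) atTop (𝓝 0) := by
    refine squeeze_zero_norm (fun k => ?_) hlim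
    rw [norm_mul, norm_inv, Real.norm_eq_abs, Real.norm_eq_abs, abs_of_pos (hs0 k),
      inv_mul_le_iff₀ (hs0 k)]
    exact ht k
  have htl : Tendsto t atTop (𝓝 0) := by
    have := hs.mul hts
    simp only [mul_zero] at this
    refine this.congr fun k => ?_
    rw [mul_inv_cancel_left₀ (hs0 k).ne']
  refine mem_tangentConeAt_of_seq atTop (fun k => (s k)⁻¹) (fun k => s k • v + t k • n) ?_
    (Eventually.of_forall hmem) ?_
  · simpa using (hs.smul_const v).add (htl.smul_const n)
  · have h1 : Tendsto (fun k => v + ((s k)⁻¹ * t k) • n) atTop (𝓝 v) := by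
      simpa using (tendsto_const_nhds (x := v)).add (hts.smul_const n)
    refine h1.congr fun k => ?_
    rw [smul_add, smul_smul, smul_smul, inv_mul_cancel₀ (hs0 k).ne', one_smul]

/-- Differentiating `Φ · n = 0` along the boundary. -/
theorem IsSmoothBoundedDomain.inner_shapeOperator (hΩ : IsSmoothBoundedDomain Ω)
    (hp : p ∈ frontier Ω) {Φ : E3 → E3} (hΦ : DifferentiableAt ℝ Φ p)
    (htan : ∀ q ∈ frontier Ω, inner ℝ (Φ q) (outwardNormal Ω q) = 0) {v : E3}
    (hv : inner ℝ v (outwardNormal Ω p) = 0) :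
    inner ℝ (Φ p) (shapeOperator Ω p v) = - inner ℝ (fderiv ℝ Φ p v) (outwardNormal Ω p) := by
  have h1 := hΦ.hasFDerivAt.hasFDerivWithinAt (s := frontier Ω) |>.inner ℝ
    (hΩ.differentiableWithinAt_outwardNormal hp).hasFDerivWithinAt
  have h2 : HasFDerivWithinAt (fun q => inner ℝ (Φ q) (outwardNormal Ω q)) (0 : E3 →L[ℝ] ℝ)
      (frontier Ω) p :=
    (hasFDerivWithinAt_const (0 : ℝ) p (frontier Ω)).congr (fun q hq => htan q hq) (htan p hp)
  -- A derivative within the boundary is determined only on the tangent cone, so the product-rule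
  -- derivative and the zero derivative can be compared only at tangent `v`.
  have h3 := h1.unique_on h2 (hΩ.mem_tangentConeAt hp (by rwa [real_inner_comm]))
  have ht : tangentialPart Ω p v = v := by simp [tangentialPart, hv]
  simp only [ContinuousLinearMap.comp_apply, ContinuousLinearMap.prod_apply, fderivInnerCLM_apply,
    zero_apply] at h3
  rw [shapeOperator, ht]
  linarith

end

section

/-! ### Coordinates adapted to a direction -/

/-- The Euclidean plane. -/
abbrev E2 : Type := EuclideanSpace ℝ (Fin 2)

/-- The first two coordinates in an orthonormal basis. -/
def planeProj (b : OrthonormalBasis (Fin 3) ℝ E3) : E3 →L[ℝ] E2 :=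
  LinearMap.toContinuousLinearMap
    { toFun := fun x => !₂[inner ℝ (b 0) x, inner ℝ (b 1) x]
      map_add' := fun x y => by ext i; fin_cases i <;> simp [inner_add_right]
      map_smul' := fun c x => by ext i; fin_cases i <;> simp [inner_smul_right] }

/-- The inclusion of the plane spanned by the first two vectors of an orthonormal basis. -/
def planeIncl (b : OrthonormalBasis (Fin 3) ℝ E3) : E2 →L[ℝ] E3 :=
  LinearMap.toContinuousLinearMap
    { toFun := fun y => y 0 • b 0 + y 1 • b 1
      map_add' := fun x y => by simp only [PiLp.add_apply, add_smul]; abel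
      map_smul' := fun c x => by simp [smul_smul] }

variable (b : OrthonormalBasis (Fin 3) ℝ E3)

@[simp] theorem planeProj_zero (x : E3) : planeProj b x 0 = inner ℝ (b 0) x := rfl

@[simp] theorem planeProj_one (x : E3) : planeProj b x 1 = inner ℝ (b 1) x := rfl

theorem planeIncl_apply (y : E2) : planeIncl b y = y 0 • b 0 + y 1 • b 1 := rfl

theorem inner_basis (i j : Fin 3) : inner ℝ (b i) (b j) = if i = j then (1 : ℝ) else 0 :=
  orthonormal_iff_ite.1 b.orthonormal i j

theorem planeIncl_planeProj (x : E3) :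
    planeIncl b (planeProj b x) + inner ℝ (b 2) x • b 2 = x := by
  conv_rhs => rw [← b.sum_repr' x, Fin.sum_univ_three]
  rfl

theorem norm_sq_eq (x : E3) : ‖x‖ ^ 2 = ‖planeProj b x‖ ^ 2 + (inner ℝ (b 2) x) ^ 2 := by
  rw [← b.sum_sq_norm_inner_right x, Fin.sum_univ_three, EuclideanSpace.norm_sq_eq,
    Fin.sum_univ_two]
  simp

theorem planeProj_add (y : E2) (t : ℝ) : planeProj b (planeIncl b y + t • b 2) = y := by
  ext i
  fin_cases i <;> simp [planeIncl_apply]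

theorem inner_two_add (y : E2) (t : ℝ) : inner ℝ (b 2) (planeIncl b y + t • b 2) = t := by
  simp [planeIncl_apply, inner_add_right, inner_smul_right]

theorem norm_planeIncl (y : E2) : ‖planeIncl b y‖ = ‖y‖ := by
  have h := norm_sq_eq b (planeIncl b y)
  have h1 := planeProj_add b y 0
  have h2 := inner_two_add b y 0
  simp only [zero_smul, add_zero] at h1 h2
  rw [h1, h2] at h
  simpa [sq_eq_sq₀] using h

theorem exists_orthonormalBasis_two {e : E3} (he : ‖e‖ = 1) :
    ∃ b : OrthonormalBasis (Fin 3) ℝ E3, b 2 = e := by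
  have ho : Orthonormal ℝ (({2} : Set (Fin 3)).domRestrict fun _ => e) := by
    rw [orthonormal_iff_ite]
    rintro ⟨i, hi⟩ ⟨j, hj⟩
    obtain rfl : i = 2 := hi
    obtain rfl : j = 2 := hj
    simp [Set.domRestrict, he]
  obtain ⟨b, hb⟩ := ho.exists_orthonormalBasis_extension_of_card_eq (by simp)
  exact ⟨b, hb 2 rfl⟩

/-- The area factor between two planes is the cosine of the angle between their normals: a `2 × 2`
minor of an orthogonal matrix is, up to sign, the complementary entry. The proof uses Lagrange's
identity on the truncated rows, whose norms and inner product are known from orthonormality. -/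
theorem abs_det_planeProj_comp (b' : OrthonormalBasis (Fin 3) ℝ E3) :
    |((planeProj b).comp (planeIncl b')).det| = |inner ℝ (b 2) (b' 2)| := by
  rw [← sq_eq_sq_iff_abs_eq_abs]
  have hdet : ((planeProj b).comp (planeIncl b')).det =
      inner ℝ (b 0) (b' 0) * inner ℝ (b 1) (b' 1) - inner ℝ (b 0) (b' 1) * inner ℝ (b 1) (b' 0) := by
    rw [ContinuousLinearMap.det,
      ← LinearMap.det_toMatrix (EuclideanSpace.basisFun (Fin 2) ℝ).toBasis, Matrix.det_fin_two]
    simp [LinearMap.toMatrix_apply, planeIncl_apply]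
  have hrow : ∀ i j, inner ℝ (b i) (b' 0) * inner ℝ (b j) (b' 0) +
      inner ℝ (b i) (b' 1) * inner ℝ (b j) (b' 1) + inner ℝ (b i) (b' 2) * inner ℝ (b j) (b' 2) =
      if i = j then (1 : ℝ) else 0 := by
    intro i j
    rw [← inner_basis b i j, ← b'.sum_inner_mul_inner (b i) (b j), Fin.sum_univ_three]
    simp only [real_inner_comm (b j)]
  have hcol : inner ℝ (b 0) (b' 2) ^ 2 + inner ℝ (b 1) (b' 2) ^ 2 + inner ℝ (b 2) (b' 2) ^ 2 =
      (1 : ℝ) := by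
    have := b.sum_sq_norm_inner_right (b' 2)
    rw [Fin.sum_univ_three] at this
    simpa using this
  have h00 := hrow 0 0
  have h11 := hrow 1 1
  have h01 := hrow 0 1
  simp only [↓reduceIte, Fin.isValue, zero_ne_one] at h00 h11 h01
  rw [hdet]
  generalize inner ℝ (b 0) (b' 0) = a00 at *
  generalize inner ℝ (b 0) (b' 1) = a01 at *
  generalize inner ℝ (b 0) (b' 2) = a02 at *
  generalize inner ℝ (b 1) (b' 0) = a10 at *
  generalize inner ℝ (b 1) (b' 1) = a11 at *
  generalize inner ℝ (b 1) (b' 2) = a12 at *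
  have e1 : a00 * a00 + a01 * a01 = 1 - a02 * a02 := by linarith
  have e2 : a10 * a10 + a11 * a11 = 1 - a12 * a12 := by linarith
  have e3 : a00 * a10 + a01 * a11 = - (a02 * a12) := by linarith
  have : (a00 * a11 - a01 * a10) ^ 2 =
      (a00 * a00 + a01 * a01) * (a10 * a10 + a11 * a11) - (a00 * a10 + a01 * a11) ^ 2 := by ring
  rw [this, e1, e2, e3]
  linear_combination -hcol

theorem measurePreserving_planeIncl_add :
    MeasurePreserving (fun z : E2 × ℝ => planeIncl b z.1 + z.2 • b 2) := by
  have h1 := b.measurePreserving_repr_symm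
  have h2 := PiLp.volume_preserving_toLp (Fin 3)
  have h3 := (volume_preserving_piFinSuccAbove (fun _ : Fin 3 => ℝ) 2).symm
  have h4 : MeasurePreserving (Prod.swap : E2 × ℝ → ℝ × E2) := Measure.measurePreserving_swap
  have h5 : MeasurePreserving (Prod.map id WithLp.ofLp : ℝ × E2 → ℝ × (Fin 2 → ℝ)) :=
    (MeasurePreserving.id volume).prod (PiLp.volume_preserving_ofLp (Fin 2))
  have h := h1.comp (h2.comp (h3.comp (h5.comp h4)))
  refine (funext fun z => ?_ : (fun z : E2 × ℝ => planeIncl b z.1 + z.2 • b 2) = _) ▸ h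
  obtain ⟨y, t⟩ := z
  apply b.repr.injective
  ext i
  simp only [Function.comp_apply, LinearIsometryEquiv.apply_symm_apply]
  rw [b.repr_apply_apply]
  fin_cases i <;>
  simp [planeIncl_apply, inner_add_right, inner_smul_right,
    Fin.insertNthEquiv, Fin.insertNth, Fin.succAboveCases]

/-! ### Hausdorff measure and almost isometric maps -/

/-- The normalizing constant depends on `d` alone, so it is the same in source and target and the
unnormalized Lipschitz bound carries over. -/
theorem euclideanHausdorffMeasure_image_le {X Y : Type*} [EMetricSpace X] [MeasurableSpace X]
    [BorelSpace X] [EMetricSpace Y] [MeasurableSpace Y] [BorelSpace Y] {K : NNReal} {f : X → Y}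
    {s : Set X} (h : LipschitzOnWith K f s) (d : ℕ) :
    (μHE[d] : Measure Y) (f '' s) ≤ (K : ENNReal) ^ d * (μHE[d] : Measure X) s := by
  have := h.hausdorffMeasure_image_le (d := d) (Nat.cast_nonneg d)
  rw [Measure.euclideanHausdorffMeasure_def, Measure.euclideanHausdorffMeasure_def,
    Measure.smul_apply, Measure.smul_apply, ENNReal.smul_def, ENNReal.smul_def, smul_eq_mul,
    smul_eq_mul, mul_left_comm]
  gcongr
  simpa using this

theorem volume_image_le {f : E3 → E2} {A : Set E3} {K : NNReal}
    (h : ∀ x ∈ A, ∀ y ∈ A, ‖f x - f y‖ ≤ K * ‖x - y‖) :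
    volume (f '' A) ≤ (K : ENNReal) ^ 2 * (μHE[2] : Measure E3) A := by
  rw [← EuclideanSpace.euclideanHausdorffMeasure_eq_volume]
  refine euclideanHausdorffMeasure_image_le (LipschitzOnWith.of_dist_le_mul fun x hx y hy => ?_) 2
  rw [dist_eq_norm, dist_eq_norm]
  exact h x hx y hy

theorem euclideanHausdorffMeasure_le_volume_image {f : E3 → E2} {A : Set E3} {K : NNReal}
    (h : ∀ x ∈ A, ∀ y ∈ A, ‖x - y‖ ≤ K * ‖f x - f y‖) :
    (μHE[2] : Measure E3) A ≤ (K : ENNReal) ^ 2 * volume (f '' A) := by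
  have hinj : Set.InjOn f A := fun x hx y hy hxy => by
    have := h x hx y hy
    rw [hxy, sub_self, norm_zero, mul_zero] at this
    exact sub_eq_zero.1 (norm_le_zero_iff.1 this)
  rw [← EuclideanSpace.euclideanHausdorffMeasure_eq_volume]
  have hl : LipschitzOnWith K (Function.invFunOn f A) (f '' A) := by
    refine LipschitzOnWith.of_dist_le_mul ?_
    rintro _ ⟨x, hx, rfl⟩ _ ⟨y, hy, rfl⟩
    rw [hinj.leftInvOn_invFunOn hx, hinj.leftInvOn_invFunOn hy, dist_eq_norm, dist_eq_norm]
    exact h x hx y hy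
  have := euclideanHausdorffMeasure_image_le hl 2
  rwa [hinj.invFunOn_image subset_rfl] at this

end

section

variable {Ω : Set E3} {p : E3} {b : OrthonormalBasis (Fin 3) ℝ E3}

/-! ### Surface measure of graphs -/

/-- Near a boundary point, the projection of a piece of the boundary to a transversal plane has
area close to the area of the piece times the cosine of the angle. -/
theorem IsSmoothBoundedDomain.exists_area_comparison (hΩ : IsSmoothBoundedDomain Ω)
    (hp : p ∈ frontier Ω) (hb : 0 < inner ℝ (b 2) (outwardNormal Ω p)) {θ : NNReal} (hθ : 1 < θ) :
    ∃ r > 0, ∀ A ⊆ frontier Ω ∩ Metric.ball p r,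
      ENNReal.ofReal (inner ℝ (b 2) (outwardNormal Ω p)) * (μHE[2] : Measure E3) A ≤
        (θ : ENNReal) ^ 2 * volume (planeProj b '' A) ∧
      volume (planeProj b '' A) ≤ (θ : ENNReal) ^ 2 *
        (ENNReal.ofReal (inner ℝ (b 2) (outwardNormal Ω p)) * (μHE[2] : Measure E3) A) := by
  set n := outwardNormal Ω p with hn
  have hnn : ‖n‖ = 1 := hΩ.norm_outwardNormal hp
  obtain ⟨b', hb'⟩ := exists_orthonormalBasis_two hnn
  -- `M` is the projection restricted to the tangent plane at `p`, in coordinates, and `f = M⁻¹ ∘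
  -- planeProj b` inverts the parametrization of that plane. On the boundary near `p`, `f` is almost
  -- isometric, so Hausdorff measure compares with the area of `f '' A`, and `M` contributes exactly
  -- its determinant.
  set M := (planeProj b).comp (planeIncl b') with hM
  have hdet : |M.det| = inner ℝ (b 2) n := by
    rw [hM, abs_det_planeProj_comp, hb', abs_of_pos hb]
  have hdet0 : M.det ≠ 0 := fun h0 => by rw [h0, abs_zero] at hdet; exact hb.ne hdet
  set Me := M.toContinuousLinearEquivOfDetNeZero hdet0 with hMe
  have hMe_apply : ∀ y, Me y = M y := fun y => rfl
  set f : E3 →L[ℝ] E2 := (Me.symm : E2 →L[ℝ] E2).comp (planeProj b) with hf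
  have hMf : ∀ x, M (f x) = planeProj b x := fun x => by
    rw [← hMe_apply]; simp [hf]
  have hfJ : ∀ y, f (planeIncl b' y) = y := fun y => by
    apply Me.injective
    rw [hMe_apply, hMe_apply, hMf, hM]; rfl
  have hθ' : (1 : ℝ) < θ := by exact_mod_cast hθ
  have hθ0 : (0 : ℝ) < θ := by linarith
  -- Chosen so that both distortion bounds are at most `θ`: `1 + η ≤ θ` and `(1 - η)⁻¹ = θ`.
  set η : ℝ := (θ - 1) / θ with hη
  have hη0 : 0 < η := div_pos (by linarith) hθ0
  have hηθ : θ * η = θ - 1 := by rw [hη]; field_simp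
  have hη1 : η < 1 := by rw [hη, div_lt_one hθ0]; linarith
  have hη2 : 1 + η ≤ θ := by nlinarith
  have hη3 : θ * (1 - η) = 1 := by linarith
  -- For boundary points, `v = x - y` has normal component `s` with `|s| ≤ ε ‖v‖`. Dropping it
  -- changes `‖f v‖` by at most `|s| ‖f n‖` and `‖v‖` by at most `|s|`.
  set ε := η / (1 + ‖f n‖) with hε
  have hfn : 0 < 1 + ‖f n‖ := by positivity
  have hε0 : 0 < ε := by positivity
  have hεη : ε * (1 + ‖f n‖) = η := by rw [hε]; field_simp
  have hε1 : ε < 1 := by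
    have : ε ≤ η := by nlinarith [norm_nonneg (f n)]
    linarith
  obtain ⟨ρ, -, -, r, hr, -, hfr, hest⟩ := hΩ.exists_almost_affine hp hε0 hε1
  have hclose : ∀ x ∈ frontier Ω ∩ Metric.ball p r, ∀ y ∈ frontier Ω ∩ Metric.ball p r,
      |‖f x - f y‖ - ‖x - y‖| ≤ η * ‖x - y‖ := by
    intro x hx y hy
    have h0 := hest x hx.2 y hy.2
    rw [(hfr x hx.2).1 hx.1, (hfr y hy.2).1 hy.1, sub_self, zero_sub, abs_neg] at h0
    rw [← map_sub]
    set v := x - y with hv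
    set s := inner ℝ n v with hs
    have hdec : planeIncl b' (planeProj b' v) + s • n = v := by
      have := planeIncl_planeProj b' v
      rwa [hb'] at this
    have hfv : f v = planeProj b' v + s • f n := by
      conv_lhs => rw [← hdec]
      rw [map_add, hfJ, map_smul]
    have h1 : |‖f v‖ - ‖planeProj b' v‖| ≤ |s| * ‖f n‖ := by
      refine (abs_norm_sub_norm_le _ _).trans_eq ?_
      rw [hfv, add_sub_cancel_left, norm_smul, Real.norm_eq_abs]
    have h2 : |‖planeProj b' v‖ - ‖v‖| ≤ |s| := by
      have : |‖planeIncl b' (planeProj b' v)‖ - ‖v‖| ≤ ‖planeIncl b' (planeProj b' v) - v‖ :=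
        abs_norm_sub_norm_le _ _
      rw [norm_planeIncl] at this
      refine this.trans_eq ?_
      conv_lhs => rw [← hdec]
      simp [norm_smul, planeProj_add, ← hb']
    calc |‖f v‖ - ‖v‖| ≤ |‖f v‖ - ‖planeProj b' v‖| + |‖planeProj b' v‖ - ‖v‖| :=
          abs_sub_le _ _ _
      _ ≤ |s| * (1 + ‖f n‖) := by linarith
      _ ≤ ε * ‖v‖ * (1 + ‖f n‖) := by gcongr
      _ = η * ‖v‖ := by rw [← hεη]; ring
  refine ⟨r, hr, fun A hA => ?_⟩
  have hA1 := volume_image_le (f := f) (A := A) (K := θ) fun x hx y hy => by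
    have := (abs_le.1 (hclose x (hA hx) y (hA hy))).2
    nlinarith [norm_nonneg (x - y)]
  have hA2 := euclideanHausdorffMeasure_le_volume_image (f := f) (A := A) (K := θ)
    fun x hx y hy => by
      have := (abs_le.1 (hclose x (hA hx) y (hA hy))).1
      have h3 : (1 - η) * ‖x - y‖ ≤ ‖f x - f y‖ := by linarith
      calc ‖x - y‖ = θ * ((1 - η) * ‖x - y‖) := by rw [← mul_assoc, hη3, one_mul]
        _ ≤ θ * ‖f x - f y‖ := by gcongr
  have hvol : volume (planeProj b '' A) =
      ENNReal.ofReal (inner ℝ (b 2) n) * volume (f '' A) := by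
    rw [← hdet, ← Measure.addHaar_image_continuousLinearMap, Set.image_image]
    simp only [hMf]
  rw [hvol]
  constructor
  · rw [mul_left_comm]; gcongr
  · rw [mul_left_comm]; gcongr

/-- By second countability, countably many of the neighbourhoods cover `s`; cutting `A` along their
disjointed versions lets the local inequalities be summed. -/
theorem measure_le_of_locally_le {X : Type*} [TopologicalSpace X] [SecondCountableTopology X]
    [MeasurableSpace X] [OpensMeasurableSpace X] {μ ν : Measure X} {s : Set X}
    (h : ∀ x ∈ s, ∃ U, IsOpen U ∧ x ∈ U ∧ ∀ A ⊆ s ∩ U, MeasurableSet A → μ A ≤ ν A)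
    {A : Set X} (hA : MeasurableSet A) (hAs : A ⊆ s) : μ A ≤ ν A := by
  choose! U hUo hxU hU using h
  obtain ⟨t, hts, htc, htU⟩ := TopologicalSpace.countable_cover_nhdsWithin
    (fun x hx => mem_nhdsWithin_of_mem_nhds ((hUo x hx).mem_nhds (hxU x hx)))
  rcases t.eq_empty_or_nonempty with rfl | hne
  · simp only [Set.mem_empty_iff_false, Set.iUnion_of_empty, Set.iUnion_empty,
      Set.subset_empty_iff] at htU
    rw [htU, Set.subset_empty_iff] at hAs
    simp [hAs]
  obtain ⟨x, rfl⟩ := htc.exists_eq_range hne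
  have hx : ∀ k, x k ∈ s := fun k => hts ⟨k, rfl⟩
  set D : ℕ → Set X := fun k => A ∩ disjointed (fun k => U (x k)) k with hD
  have hDm : ∀ k, MeasurableSet (D k) := fun k =>
    hA.inter (MeasurableSet.disjointed (fun k => (hUo _ (hx k)).measurableSet) k)
  have hDd : Pairwise (Function.onFun Disjoint D) := fun i j hij =>
    (disjoint_disjointed (fun k => U (x k)) hij).mono Set.inter_subset_right Set.inter_subset_right
  have hAD : A = ⋃ k, D k := by
    rw [← Set.inter_iUnion, iUnion_disjointed, eq_comm, Set.inter_eq_left]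
    refine hAs.trans (htU.trans ?_)
    simp
  rw [hAD, measure_iUnion hDd hDm, measure_iUnion hDd hDm]
  refine ENNReal.tsum_le_tsum fun k => hU _ (hx k) _ ?_ (hDm k)
  exact fun z hz => ⟨hAs hz.1, disjointed_subset (fun k => U (x k)) k hz.2⟩

/-- The area formula for a piece of the boundary which is a graph in the direction `b 2`. -/
theorem IsSmoothBoundedDomain.map_graph (hΩ : IsSmoothBoundedDomain Ω) {U : Set E2}
    (hU : MeasurableSet U) {ψ : E2 → E3} (hψ : ContinuousOn ψ U)
    (hP : ∀ y ∈ U, planeProj b (ψ y) = y) (hfr : ∀ y ∈ U, ψ y ∈ frontier Ω)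
    (hpos : ∀ y ∈ U, 0 < inner ℝ (b 2) (outwardNormal Ω (ψ y))) :
    (volume.restrict U).map ψ = ((μHE[2] : Measure E3).restrict (ψ '' U)).withDensity
      fun x => ENNReal.ofReal (inner ℝ (b 2) (outwardNormal Ω x)) := by
  have hinj : Set.InjOn ψ U := fun y hy z hz h => by rw [← hP y hy, ← hP z hz, h]
  have hΓ : MeasurableSet (ψ '' U) := hU.image_of_continuousOn_injOn hψ hinj
  have hψm : AEMeasurable ψ (volume.restrict U) := hψ.aemeasurable hU
  set ν₁ := ((μHE[2] : Measure E3).restrict (ψ '' U)).withDensity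
      fun x => ENNReal.ofReal (inner ℝ (b 2) (outwardNormal Ω x)) with hν₁
  set ν₂ := (volume.restrict U).map ψ with hν₂
  have h1 : ∀ A, MeasurableSet A → A ⊆ ψ '' U → ν₁ A =
      ∫⁻ x in A, ENNReal.ofReal (inner ℝ (b 2) (outwardNormal Ω x)) ∂(μHE[2] : Measure E3) := by
    intro A hA hAs
    rw [hν₁, withDensity_apply _ hA, Measure.restrict_restrict hA, Set.inter_eq_left.2 hAs]
  -- Since the projection inverts `ψ` on `U`, the preimage of `A` under `ψ` in `U` is the projection
  -- of `A`.
  have h2 : ∀ A, MeasurableSet A → A ⊆ ψ '' U → ν₂ A = volume (planeProj b '' A) := by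
    intro A hA hAs
    rw [hν₂, Measure.map_apply_of_aemeasurable hψm hA, Measure.restrict_apply' hU]
    congr 1
    ext y
    constructor
    · rintro ⟨hy, hyU⟩
      exact ⟨ψ y, hy, hP y hyU⟩
    · rintro ⟨x, hx, rfl⟩
      obtain ⟨y, hy, rfl⟩ := hAs hx
      rw [hP y hy]
      exact ⟨hx, hy⟩
  -- The area comparison at `x` costs `θ ^ 2`, with the density frozen at `x`; letting the density
  -- vary continuously costs one more factor `θ`. The two measures are then compared globally, and
  -- `θ → 1` gives equality.
  have hcomp : ∀ θ : NNReal, 1 < θ → ∀ x ∈ ψ '' U, ∃ V, IsOpen V ∧ x ∈ V ∧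
      ∀ A ⊆ ψ '' U ∩ V, MeasurableSet A →
        ν₁ A ≤ (θ ^ 3 • ν₂) A ∧ ν₂ A ≤ (θ ^ 3 • ν₁) A := by
    intro θ hθ x hx
    have hxf : x ∈ frontier Ω := by obtain ⟨y, hy, rfl⟩ := hx; exact hfr y hy
    have hxp : 0 < inner ℝ (b 2) (outwardNormal Ω x) := by
      obtain ⟨y, hy, rfl⟩ := hx; exact hpos y hy
    obtain ⟨r, hr, hA⟩ := hΩ.exists_area_comparison hxf hxp hθ
    set c := inner ℝ (b 2) (outwardNormal Ω x) with hc
    have hθ' : (1 : ℝ) < θ := by exact_mod_cast hθ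
    have hcont : ContinuousWithinAt (fun z => inner ℝ (b 2) (outwardNormal Ω z)) (frontier Ω) x :=
      continuousWithinAt_const.inner (hΩ.continuousOn_outwardNormal x hxf)
    have hlo : ∀ᶠ z in 𝓝[frontier Ω] x, c < θ * inner ℝ (b 2) (outwardNormal Ω z) := by
      have : c < θ * c := by nlinarith
      exact (hcont.const_mul (θ : ℝ)).eventually (lt_mem_nhds this)
    have hhi : ∀ᶠ z in 𝓝[frontier Ω] x, inner ℝ (b 2) (outwardNormal Ω z) < θ * c := by
      have : c < θ * c := by nlinarith
      exact hcont.eventually (gt_mem_nhds this)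
    obtain ⟨V, hVo, hxV, hV⟩ := mem_nhdsWithin.1 (hlo.and hhi)
    refine ⟨V ∩ Metric.ball x r, hVo.inter Metric.isOpen_ball, ⟨hxV, Metric.mem_ball_self hr⟩,
      fun A hAs hAm => ?_⟩
    have hAΓ : A ⊆ ψ '' U := fun z hz => (hAs hz).1
    have hAf : A ⊆ frontier Ω := fun z hz => by
      obtain ⟨y, hy, rfl⟩ := hAΓ hz; exact hfr y hy
    obtain ⟨hle, hge⟩ := hA A fun z hz => ⟨hAf hz, (hAs hz).2.2⟩
    rw [Measure.smul_apply, Measure.smul_apply, ENNReal.smul_def, ENNReal.smul_def, smul_eq_mul,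
      smul_eq_mul, h1 A hAm hAΓ, h2 A hAm hAΓ, ENNReal.coe_pow]
    have hθof : ENNReal.ofReal (θ : ℝ) = θ := ENNReal.ofReal_coe_nnreal
    constructor
    · calc ∫⁻ z in A, ENNReal.ofReal (inner ℝ (b 2) (outwardNormal Ω z)) ∂(μHE[2] : Measure E3)
          ≤ ∫⁻ z in A, ENNReal.ofReal (θ * c) ∂(μHE[2] : Measure E3) :=
            setLIntegral_mono' hAm fun z hz =>
              ENNReal.ofReal_le_ofReal (hV ⟨(hAs hz).2.1, hAf hz⟩).2.le
        _ = θ * (ENNReal.ofReal c * (μHE[2] : Measure E3) A) := by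
            rw [setLIntegral_const, ENNReal.ofReal_mul (by linarith), hθof, mul_assoc]
        _ ≤ θ * (θ ^ 2 * volume (planeProj b '' A)) := by gcongr
        _ = θ ^ 3 * volume (planeProj b '' A) := by ring
    · calc volume (planeProj b '' A)
          ≤ θ ^ 2 * (ENNReal.ofReal c * (μHE[2] : Measure E3) A) := hge
        _ = θ ^ 2 * ∫⁻ z in A, ENNReal.ofReal c ∂(μHE[2] : Measure E3) := by
            rw [setLIntegral_const]
        _ ≤ θ ^ 2 * ∫⁻ z in A, θ * ENNReal.ofReal (inner ℝ (b 2) (outwardNormal Ω z))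
              ∂(μHE[2] : Measure E3) := by
            gcongr 1
            refine setLIntegral_mono' hAm fun z hz => ?_
            rw [← hθof, ← ENNReal.ofReal_mul (by linarith)]
            exact ENNReal.ofReal_le_ofReal (hV ⟨(hAs hz).2.1, hAf hz⟩).1.le
        _ = θ ^ 3 * ∫⁻ z in A, ENNReal.ofReal (inner ℝ (b 2) (outwardNormal Ω z))
              ∂(μHE[2] : Measure E3) := by
            rw [lintegral_const_mul' _ _ ENNReal.coe_ne_top]; ring
  have hlim : Tendsto (fun k : ℕ => ((1 + 1 / ((k : NNReal) + 1) : NNReal) : ENNReal) ^ 3) atTop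
      (𝓝 1) := by
    have h0 : Tendsto (fun k : ℕ => 1 / ((k : NNReal) + 1)) atTop (𝓝 0) :=
      tendsto_one_div_add_atTop_nhds_zero_nat
    have h3 : Tendsto (fun k : ℕ => (1 + 1 / ((k : NNReal) + 1)) ^ 3) atTop (𝓝 1) := by
      simpa using (h0.const_add 1).pow 3
    have := ENNReal.tendsto_coe.2 h3
    simpa using this
  have hgt : ∀ k : ℕ, (1 : NNReal) < 1 + 1 / ((k : NNReal) + 1) := fun k =>
    lt_add_of_pos_right _ (by positivity)
  have hsub : ∀ A, MeasurableSet A → A ⊆ ψ '' U → ν₁ A = ν₂ A := by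
    intro A hA hAs
    apply le_antisymm
    · have hl := ENNReal.Tendsto.mul_const hlim (b := ν₂ A) (Or.inl one_ne_zero)
      rw [one_mul] at hl
      refine ge_of_tendsto' hl fun k => ?_
      have := measure_le_of_locally_le (μ := ν₁) (s := ψ '' U) (fun x hx => by
        obtain ⟨V, hV, hxV, h⟩ := hcomp _ (hgt k) x hx
        exact ⟨V, hV, hxV, fun A hA hm => (h A hA hm).1⟩) hA hAs
      rwa [Measure.smul_apply, ENNReal.smul_def, smul_eq_mul, ENNReal.coe_pow] at this
    · have hl := ENNReal.Tendsto.mul_const hlim (b := ν₁ A) (Or.inl one_ne_zero)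
      rw [one_mul] at hl
      refine ge_of_tendsto' hl fun k => ?_
      have := measure_le_of_locally_le (μ := ν₂) (s := ψ '' U) (fun x hx => by
        obtain ⟨V, hV, hxV, h⟩ := hcomp _ (hgt k) x hx
        exact ⟨V, hV, hxV, fun A hA hm => (h A hA hm).2⟩) hA hAs
      rwa [Measure.smul_apply, ENNReal.smul_def, smul_eq_mul, ENNReal.coe_pow] at this
  have hc1 : ν₁ (ψ '' U)ᶜ = 0 := by
    refine withDensity_absolutelyContinuous _ _ ?_
    rw [Measure.restrict_apply hΓ.compl, Set.compl_inter_self, measure_empty]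
  have hc2 : ν₂ (ψ '' U)ᶜ = 0 := by
    rw [hν₂, Measure.map_apply_of_aemeasurable hψm hΓ.compl, Measure.restrict_apply' hU]
    convert measure_empty (μ := (volume : Measure E2))
    ext y
    simp only [Set.preimage_compl, Set.mem_inter_iff, Set.mem_compl_iff, Set.mem_preimage,
      Set.mem_empty_iff_false, iff_false, not_and]
    intro h hy
    exact h ⟨y, hy, rfl⟩
  ext A hA
  rw [← measure_inter_add_sdiff A hΓ, ← measure_inter_add_sdiff (μ := ν₁) A hΓ,
    hsub _ (hA.inter hΓ) Set.inter_subset_right, measure_mono_null (Set.sdiff_subset_compl _ _) hc1,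
    measure_mono_null (Set.sdiff_subset_compl _ _) hc2]

theorem IsSmoothBoundedDomain.isCompact_frontier (hΩ : IsSmoothBoundedDomain Ω) :
    IsCompact (frontier Ω) :=
  Metric.isCompact_of_isClosed_isBounded isClosed_frontier
    (hΩ.isBounded.closure.subset frontier_subset_closure)

/-- By compactness it suffices to bound small pieces. Projecting along the normal at `p` with `θ =
2`, a piece has at most four times the area of its bounded projection. -/
theorem IsSmoothBoundedDomain.isFiniteMeasure_surfaceMeasure (hΩ : IsSmoothBoundedDomain Ω) :
    IsFiniteMeasure (surfaceMeasure Ω) := by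
  refine ⟨?_⟩
  rw [surfaceMeasure, Measure.restrict_apply_univ]
  refine hΩ.isCompact_frontier.measure_lt_top_of_nhdsWithin fun p hp => ?_
  have hn := hΩ.norm_outwardNormal hp
  obtain ⟨b, hb⟩ := exists_orthonormalBasis_two hn
  have hpos : inner ℝ (b 2) (outwardNormal Ω p) = (1 : ℝ) := by
    rw [hb, real_inner_self_eq_norm_sq, hn, one_pow]
  obtain ⟨r, hr, h⟩ := hΩ.exists_area_comparison (b := b) hp (by rw [hpos]; norm_num)
    (θ := 2) (by norm_num)
  refine ⟨frontier Ω ∩ Metric.ball p r, inter_mem_nhdsWithin _ (Metric.ball_mem_nhds p hr), ?_⟩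
  have h1 := (h _ subset_rfl).1
  rw [hpos, ENNReal.ofReal_one, one_mul] at h1
  refine h1.trans_lt (ENNReal.mul_lt_top (by simp) ?_)
  have : Bornology.IsBounded (planeProj b '' (frontier Ω ∩ Metric.ball p r)) :=
    ((planeProj b).lipschitz.isBounded_image (Metric.isBounded_ball.subset Set.inter_subset_right))
  exact this.measure_lt_top

end

section

variable {Ω : Set E3} {p : E3} {b : OrthonormalBasis (Fin 3) ℝ E3}

/-! ### The boundary as a graph, and the divergence theorem -/

/-- In a direction transversal to the boundary, the domain is locally a subgraph. -/
theorem IsSmoothBoundedDomain.exists_graph (hΩ : IsSmoothBoundedDomain Ω)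
    (hp : p ∈ frontier Ω) (hb : 0 < inner ℝ (b 2) (outwardNormal Ω p)) :
    ∃ (U : Set E2) (t₀ δ : ℝ) (g : E2 → ℝ), IsOpen U ∧ Bornology.IsBounded U ∧ planeProj b p ∈ U ∧
      |inner ℝ (b 2) p - t₀| < δ ∧ ContinuousOn g U ∧ (∀ y ∈ U, |g y - t₀| < δ) ∧
      ∀ y ∈ U, ∀ t : ℝ, |t - t₀| < δ →
        (planeIncl b y + t • b 2 ∈ Ω ↔ t < g y) ∧
        (planeIncl b y + t • b 2 ∈ frontier Ω ↔ t = g y) ∧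
        (planeIncl b y + t • b 2 ∈ frontier Ω →
          0 < inner ℝ (b 2) (outwardNormal Ω (planeIncl b y + t • b 2))) := by
  set n := outwardNormal Ω p with hn
  have hnn : ‖n‖ = 1 := hΩ.norm_outwardNormal hp
  have hb1 : ‖b 2‖ = 1 := b.norm_eq_one 2
  set c := inner ℝ (b 2) n with hc
  have hc1 : c ≤ 1 := by simpa [hnn, hb1] using real_inner_le_norm (b 2) n
  -- Slope error `c / 2` against slope `c` in the direction `b 2` leaves `ρ` strictly increasing
  -- along that direction.
  obtain ⟨ρ, hρc, hρp, r₁, hr₁, hΩr, hfr, hest⟩ :=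
    hΩ.exists_almost_affine hp (half_pos hb) (by linarith)
  obtain ⟨r₂, hr₂, hpos⟩ : ∃ r > 0, ∀ x ∈ Metric.ball p r, x ∈ frontier Ω →
      0 < inner ℝ (b 2) (outwardNormal Ω x) := by
    have hcont : ContinuousWithinAt (fun z => inner ℝ (b 2) (outwardNormal Ω z)) (frontier Ω) p :=
      continuousWithinAt_const.inner (hΩ.continuousOn_outwardNormal p hp)
    have := hcont.eventually (lt_mem_nhds hb)
    rw [eventually_nhdsWithin_iff, Metric.eventually_nhds_iff_ball] at this
    exact this
  set r := min r₁ r₂ with hr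
  have hr0 : 0 < r := lt_min hr₁ hr₂
  set t₀ := inner ℝ (b 2) p with ht₀
  set y₀ := planeProj b p with hy₀
  set δ := r / 4 with hδ
  have hδ0 : 0 < δ := by positivity
  have hpdec : planeIncl b y₀ + t₀ • b 2 = p := planeIncl_planeProj b p
  set X : E2 → ℝ → E3 := fun y t => planeIncl b y + t • b 2 with hX
  have hXc : Continuous fun z : E2 × ℝ => X z.1 z.2 := by
    simp only [hX]; fun_prop
  have hXmem : ∀ y t, ‖y - y₀‖ < δ → |t - t₀| ≤ δ → X y t ∈ Metric.ball p r := by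
    intro y t hy ht
    have : X y t - p = planeIncl b (y - y₀) + (t - t₀) • b 2 := by
      rw [← hpdec, hX, map_sub, sub_smul]; simp only; abel
    rw [Metric.mem_ball, dist_eq_norm, this]
    refine (norm_add_le _ _).trans_lt ?_
    rw [norm_planeIncl, norm_smul, hb1, Real.norm_eq_abs, mul_one]
    linarith
  have hX1 : ∀ y t, ‖y - y₀‖ < δ → |t - t₀| ≤ δ → X y t ∈ Metric.ball p r₁ := fun y t hy ht =>
    Metric.ball_subset_ball (min_le_left _ _) (hXmem y t hy ht)
  have hmono : ∀ y, ‖y - y₀‖ < δ → ∀ s t, |s - t₀| ≤ δ → |t - t₀| ≤ δ → s < t →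
      ρ (X y s) < ρ (X y t) := by
    intro y hy s t hs ht hst
    have h1 := hest _ (hX1 y t hy ht) _ (hX1 y s hy hs)
    have h2 : X y t - X y s = (t - s) • b 2 := by
      simp only [hX, sub_smul]; abel
    rw [h2, inner_smul_right, norm_smul, hb1, mul_one, real_inner_comm, ← hc, Real.norm_eq_abs,
      abs_of_pos (by linarith : 0 < t - s)] at h1
    have h3 := (abs_le.1 h1).1
    nlinarith
  -- The lines over `U` meet the bottom of the cylinder inside `Ω` and the top outside its closure,
  -- so monotonicity gives exactly one crossing, at height `g y`.
  set U : Set E2 := {y | ‖y - y₀‖ < δ ∧ ρ (X y (t₀ - δ)) < 0 ∧ 0 < ρ (X y (t₀ + δ))} with hU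
  have hUo : IsOpen U := by
    have h1 : Continuous fun y => ρ (X y (t₀ - δ)) := by simp only [hX]; fun_prop
    have h2 : Continuous fun y => ρ (X y (t₀ + δ)) := by simp only [hX]; fun_prop
    have h0 : Continuous fun y : E2 => ‖y - y₀‖ := by fun_prop
    exact (isOpen_lt h0 continuous_const).inter
      ((isOpen_lt h1 continuous_const).inter (isOpen_lt continuous_const h2))
  have hX0 : X y₀ t₀ = p := hpdec
  have hy₀0 : ‖y₀ - y₀‖ < δ := by simpa using hδ0
  have hy₀U : y₀ ∈ U := by
    refine ⟨hy₀0, ?_, ?_⟩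
    · have := hmono y₀ hy₀0 (t₀ - δ) t₀ (by simp [abs_of_pos hδ0]) (by simp [hδ0.le]) (by linarith)
      rwa [hX0, hρp] at this
    · have := hmono y₀ hy₀0 t₀ (t₀ + δ) (by simp [hδ0.le]) (by simp [abs_of_pos hδ0]) (by linarith)
      rwa [hX0, hρp] at this
  have hex : ∀ y ∈ U, ∃ t, |t - t₀| < δ ∧ ρ (X y t) = 0 := by
    rintro y ⟨hy1, hy2, hy3⟩
    have hcont : ContinuousOn (fun t : ℝ => ρ (X y t)) (Set.Icc (t₀ - δ) (t₀ + δ)) := by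
      simp only [hX]; fun_prop
    obtain ⟨t, ht, ht0⟩ := intermediate_value_Ioo (by linarith) hcont
      (show (0 : ℝ) ∈ Set.Ioo _ _ from ⟨hy2, hy3⟩)
    exact ⟨t, abs_lt.2 ⟨by linarith [ht.1], by linarith [ht.2]⟩, ht0⟩
  choose! g hgδ hg0 using hex
  have hiff : ∀ y ∈ U, ∀ t, |t - t₀| < δ → (ρ (X y t) < 0 ↔ t < g y) ∧ (ρ (X y t) = 0 ↔ t = g y) := by
    intro y hy t ht
    rcases lt_trichotomy t (g y) with h | h | h
    · have := hmono y hy.1 t (g y) ht.le (hgδ y hy).le h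
      rw [hg0 y hy] at this
      exact ⟨⟨fun _ => h, fun _ => this⟩, ⟨fun h0 => absurd h0 this.ne, fun h0 => absurd h0 h.ne⟩⟩
    · rw [h, hg0 y hy]; simp
    · have := hmono y hy.1 (g y) t (hgδ y hy).le ht.le h
      rw [hg0 y hy] at this
      exact ⟨⟨fun h0 => absurd h0 this.not_gt, fun h0 => absurd h0 h.not_gt⟩,
        ⟨fun h0 => absurd h0 this.ne', fun h0 => absurd h0 h.ne'⟩⟩
  refine ⟨U, t₀, δ, g, hUo, ?_, hy₀U, by simpa using hδ0, ?_, hgδ, fun y hy t ht => ⟨?_, ?_, ?_⟩⟩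
  · refine (Metric.isBounded_ball (x := y₀) (r := δ)).subset fun y hy => ?_
    rw [Metric.mem_ball, dist_eq_norm]; exact hy.1
  -- Since `ρ` vanishes at both graph points, `c |Δg| ≤ |Δy| + (c / 2)(|Δy| + |Δg|)`. Absorbing the
  -- last term and using `c ≤ 1` yields the constant `4 / c`.
  · have hl : LipschitzOnWith (4 / c).toNNReal g U := by
      refine LipschitzOnWith.of_dist_le_mul fun y hy z hz => ?_
      rw [Real.coe_toNNReal _ (by positivity), Real.dist_eq, dist_eq_norm]
      have h1 := hest _ (hX1 y _ hy.1 (hgδ y hy).le) _ (hX1 z _ hz.1 (hgδ z hz).le)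
      have h2 : X y (g y) - X z (g z) = planeIncl b (y - z) + (g y - g z) • b 2 := by
        simp only [hX, sub_smul, map_sub]; abel
      rw [hg0 y hy, hg0 z hz, sub_self, zero_sub, abs_neg, h2, inner_add_right, inner_smul_right,
        real_inner_comm (b 2), ← hc] at h1
      have h3 : |inner ℝ n (planeIncl b (y - z))| ≤ ‖y - z‖ := by
        have := abs_real_inner_le_norm n (planeIncl b (y - z))
        rwa [hnn, one_mul, norm_planeIncl] at this
      have h4 : ‖planeIncl b (y - z) + (g y - g z) • b 2‖ ≤ ‖y - z‖ + |g y - g z| := by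
        refine (norm_add_le _ _).trans_eq ?_
        rw [norm_planeIncl, norm_smul, hb1, mul_one, Real.norm_eq_abs]
      have h5 : |(g y - g z) * c| ≤ |inner ℝ n (planeIncl b (y - z)) + (g y - g z) * c| +
          |inner ℝ n (planeIncl b (y - z))| := by
        have := abs_sub (inner ℝ n (planeIncl b (y - z)) + (g y - g z) * c)
          (inner ℝ n (planeIncl b (y - z)))
        rwa [add_sub_cancel_left] at this
      rw [abs_mul, abs_of_pos hb] at h5
      have h6 : c / 2 * ‖planeIncl b (y - z) + (g y - g z) • b 2‖ ≤
          c / 2 * (‖y - z‖ + |g y - g z|) := by gcongr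
      rw [div_mul_eq_mul_div, le_div_iff₀ hb]
      nlinarith [norm_nonneg (y - z)]
    exact hl.continuousOn
  · exact (hΩr _ (hX1 y t hy.1 ht.le)).trans (hiff y hy t ht).1
  · exact (hfr _ (hX1 y t hy.1 ht.le)).trans (hiff y hy t ht).2
  · exact hpos _ (Metric.ball_subset_ball (min_le_right _ _) (hXmem y t hy.1 ht.le))

/-- The divergence theorem for functions supported near a boundary point, in a direction pointing
outwards at that point. -/
theorem IsSmoothBoundedDomain.exists_integral_fderiv_transversal (hΩ : IsSmoothBoundedDomain Ω)
    (hp : p ∈ frontier Ω) (hb : 0 < inner ℝ (b 2) (outwardNormal Ω p)) :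
    ∃ W, IsOpen W ∧ p ∈ W ∧ ∀ φ : E3 → ℝ, ContDiff ℝ ∞ φ → tsupport φ ⊆ W →
      ∫ x in Ω, fderiv ℝ φ x (b 2) =
        ∫ x, φ x * inner ℝ (b 2) (outwardNormal Ω x) ∂(surfaceMeasure Ω) := by
  obtain ⟨U, t₀, δ, g, hUo, hUb, hpU, hpt, hgc, hgδ, hg⟩ := hΩ.exists_graph hp hb
  set W : Set E3 := {x | planeProj b x ∈ U ∧ |inner ℝ (b 2) x - t₀| < δ} with hW
  have hWo : IsOpen W := by
    have h0 : Continuous fun x : E3 => |inner ℝ (b 2) x - t₀| := by fun_prop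
    exact (hUo.preimage (planeProj b).continuous).inter (isOpen_lt h0 continuous_const)
  refine ⟨W, hWo, ⟨hpU, hpt⟩, fun φ hφ hsupp => ?_⟩
  have hXW : ∀ (y : E2) (t : ℝ), planeIncl b y + t • b 2 ∈ W ↔ y ∈ U ∧ |t - t₀| < δ := by
    intro y t
    simp only [hW, Set.mem_ofPred_eq, planeProj_add, inner_two_add]
  have hWb : Bornology.IsBounded W := by
    obtain ⟨R, hR⟩ := hUb.subset_closedBall 0
    refine (Metric.isBounded_closedBall (x := (0 : E3)) (r := R + (|t₀| + δ))).subset fun x hx => ?_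
    rw [mem_closedBall_zero_iff, ← planeIncl_planeProj b x]
    refine (norm_add_le _ _).trans ?_
    rw [norm_planeIncl, norm_smul, b.norm_eq_one, mul_one, Real.norm_eq_abs]
    have h1 := mem_closedBall_zero_iff.1 (hR hx.1)
    have h2 := abs_sub_abs_le_abs_sub (inner ℝ (b 2) x) t₀
    have h3 := hx.2
    linarith
  have hcs : HasCompactSupport φ :=
    Metric.isCompact_of_isClosed_isBounded (isClosed_tsupport φ) (hWb.subset hsupp)
  have hφc : Continuous φ := hφ.continuous
  set F : E3 → ℝ := fun x => fderiv ℝ φ x (b 2) with hF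
  have hFc : Continuous F := (hφ.continuous_fderiv (by simp)).clm_apply continuous_const
  have hFs : Function.support F ⊆ tsupport φ := fun x hx => by
    refine support_fderiv_subset ℝ fun h0 => hx ?_
    simp [hF, h0]
  have hF0 : ∀ x, x ∉ W → F x = 0 := fun x hx => by
    by_contra h; exact hx (hsupp (hFs h))
  have hφ0 : ∀ x, x ∉ W → φ x = 0 := fun x hx => by
    by_contra h; exact hx (hsupp (subset_tsupport φ h))
  have hFi : Integrable F := hFc.integrable_of_hasCompactSupport
    (hcs.mono' hFs)
  have hmp := measurePreserving_planeIncl_add b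
  set ψ : E2 → E3 := fun y => planeIncl b y + g y • b 2 with hψ
  have hψc : ContinuousOn ψ U :=
    (planeIncl b).continuous.continuousOn.add (hgc.smul continuousOn_const)
  have hψW : ∀ y ∈ U, ψ y ∈ W := fun y hy => (hXW y (g y)).2 ⟨hy, hgδ y hy⟩
  have hψfr : ∀ y ∈ U, ψ y ∈ frontier Ω := fun y hy => (hg y hy (g y) (hgδ y hy)).2.1.2 rfl
  -- Fubini in the coordinates `(y, t)`, then the fundamental theorem of calculus on each line from
  -- `-∞`, where `φ` vanishes, up to the boundary height `g y`.
  have hleft : ∫ x in Ω, F x = ∫ y in U, φ (ψ y) := by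
    rw [← integral_indicator hΩ.isOpen.measurableSet]
    have hind : Integrable (Ω.indicator F) := hFi.indicator hΩ.isOpen.measurableSet
    have hemb : MeasurableEmbedding (fun z : E2 × ℝ => planeIncl b z.1 + z.2 • b 2) := by
      refine Continuous.measurableEmbedding (by fun_prop) fun z w h => ?_
      have h1 := congrArg (planeProj b) h
      have h2 := congrArg (inner ℝ (b 2)) h
      simp only [planeProj_add, inner_two_add] at h1 h2
      exact Prod.ext h1 h2
    rw [← hmp.integral_comp hemb, Measure.volume_eq_prod, integral_prod]
    swap
    · rw [← Measure.volume_eq_prod]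
      exact (hmp.integrable_comp_emb hemb).2 hind
    rw [← integral_indicator hUo.measurableSet]
    congr 1
    ext y
    by_cases hy : y ∈ U
    · rw [Set.indicator_of_mem hy]
      -- The subgraph description is known only for `|t - t₀| < δ`; beyond that `F` vanishes, so the
      -- half-line may replace the slice of `Ω`.
      have heq : (fun t : ℝ => Ω.indicator F (planeIncl b y + t • b 2)) =
          (Set.Iio (g y)).indicator fun t => F (planeIncl b y + t • b 2) := by
        ext t
        by_cases ht : |t - t₀| < δ
        · have := (hg y hy t ht).1
          by_cases h : t < g y
          · rw [Set.indicator_of_mem (this.2 h), Set.indicator_of_mem (Set.mem_Iio.2 h)]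
          · rw [Set.indicator_of_notMem (fun h' => h (this.1 h')),
              Set.indicator_of_notMem (fun h' => h (Set.mem_Iio.1 h'))]
        · have h0 := hF0 (planeIncl b y + t • b 2) fun h => ht ((hXW y t).1 h).2
          simp [Set.indicator_apply, h0]
      simp only [heq]
      rw [integral_indicator measurableSet_Iio, ← integral_Iic_eq_integral_Iio]
      have hline : ∀ t : ℝ, HasDerivAt (fun t : ℝ => planeIncl b y + t • b 2) (b 2) t := fun t => by
        simpa using ((hasDerivAt_id t).smul_const (b 2)).const_add (planeIncl b y)
      have hder : ∀ t : ℝ, HasDerivAt (fun t : ℝ => φ (planeIncl b y + t • b 2))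
          (F (planeIncl b y + t • b 2)) t := fun t =>
        ((hφ.differentiable (by simp) _).hasFDerivAt).comp_hasDerivAt t (hline t)
      have hcomp : HasCompactSupport fun t : ℝ => F (planeIncl b y + t • b 2) := by
        refine HasCompactSupport.intro (K := Metric.closedBall t₀ δ)
          (isCompact_closedBall t₀ δ) fun t ht => hF0 _ fun h => ht ?_
        rw [Metric.mem_closedBall, Real.dist_eq]
        exact ((hXW y t).1 h).2.le
      have hcint : Integrable fun t : ℝ => F (planeIncl b y + t • b 2) :=
        Continuous.integrable_of_hasCompactSupport (by fun_prop) hcomp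
      have hbot : Tendsto (fun t : ℝ => φ (planeIncl b y + t • b 2)) atBot (𝓝 0) := by
        refine tendsto_const_nhds.congr' ?_
        filter_upwards [eventually_lt_atBot (t₀ - δ)] with t ht
        refine (hφ0 _ fun h => ?_).symm
        have := (abs_lt.1 ((hXW y t).1 h).2).1
        linarith
      rw [integral_Iic_of_hasDerivAt_of_tendsto' (fun t _ => hder t) hcint.integrableOn hbot,
        sub_zero]
    · rw [Set.indicator_of_notMem hy]
      have h0 : ∀ t : ℝ, Ω.indicator F (planeIncl b y + t • b 2) = 0 := fun t => by
        have h0 := hF0 (planeIncl b y + t • b 2) fun h => hy ((hXW y t).1 h).1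
        simp [h0]
      simp [h0]
  have hmap := hΩ.map_graph hUo.measurableSet hψc
    (fun y hy => planeProj_add b y (g y)) hψfr
    (fun y hy => (hg y hy (g y) (hgδ y hy)).2.2 (hψfr y hy))
  have hΓ : ψ '' U = frontier Ω ∩ W := by
    ext x
    constructor
    · rintro ⟨y, hy, rfl⟩
      exact ⟨hψfr y hy, hψW y hy⟩
    · rintro ⟨hx, hxW⟩
      refine ⟨planeProj b x, hxW.1, ?_⟩
      have h1 := (hg _ hxW.1 _ hxW.2).2.1
      rw [planeIncl_planeProj] at h1
      rw [hψ]
      simp only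
      rw [← h1.1 hx, planeIncl_planeProj]
  rw [hΓ] at hmap
  have hndm : AEMeasurable (fun x => inner ℝ (b 2) (outwardNormal Ω x))
      ((μHE[2] : Measure E3).restrict (frontier Ω ∩ W)) := by
    refine ContinuousOn.aemeasurable ?_ (isClosed_frontier.measurableSet.inter hWo.measurableSet)
    exact continuousOn_const.inner (hΩ.continuousOn_outwardNormal.mono Set.inter_subset_left)
  have hposW : ∀ x ∈ frontier Ω ∩ W, 0 < inner ℝ (b 2) (outwardNormal Ω x) := by
    rintro x ⟨hx, hxW⟩
    have h1 := (hg _ hxW.1 _ hxW.2).2.2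
    rw [planeIncl_planeProj] at h1
    exact h1 hx
  -- The pushforward of planar area by `ψ` has density `⟨b 2, n⟩` with respect to surface measure,
  -- which is exactly the weight in the flux.
  rw [hleft, ← integral_map (hψc.aemeasurable hUo.measurableSet) hφc.aestronglyMeasurable, hmap,
    integral_withDensity_eq_integral_toReal_smul₀ hndm.ennreal_ofReal (by simp)]
  have hm := isClosed_frontier (s := Ω) |>.measurableSet
  calc ∫ x in frontier Ω ∩ W, (ENNReal.ofReal (inner ℝ (b 2) (outwardNormal Ω x))).toReal • φ x
        ∂(μHE[2] : Measure E3)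
      = ∫ x in frontier Ω ∩ W, φ x * inner ℝ (b 2) (outwardNormal Ω x) ∂(μHE[2] : Measure E3) := by
        refine setIntegral_congr_fun (hm.inter hWo.measurableSet) fun x hx => ?_
        simp only [smul_eq_mul]
        rw [ENNReal.toReal_ofReal (hposW x hx).le, mul_comm]
    _ = ∫ x in frontier Ω, φ x * inner ℝ (b 2) (outwardNormal Ω x) ∂(μHE[2] : Measure E3) := by
        refine (setIntegral_eq_of_subset_of_forall_sdiff_eq_zero hm Set.inter_subset_left
          fun x hx => ?_).symm
        rw [hφ0 x fun h => hx.2 ⟨hx.1, h⟩, zero_mul]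

end

/-! ### The global divergence theorem. -/

section

variable {Ω : Set E3} {p : E3}

theorem IsSmoothBoundedDomain.isCompact_closure (hΩ : IsSmoothBoundedDomain Ω) :
    IsCompact (closure Ω) :=
  Metric.isCompact_of_isClosed_isBounded isClosed_closure hΩ.isBounded.closure

theorem IsSmoothBoundedDomain.isFiniteMeasure_volume (hΩ : IsSmoothBoundedDomain Ω) :
    IsFiniteMeasure (volume.restrict Ω) :=
  ⟨by rw [Measure.restrict_apply_univ]; exact hΩ.isBounded.measure_lt_top⟩

theorem IsSmoothBoundedDomain.integrableOn (hΩ : IsSmoothBoundedDomain Ω) {f : E3 → ℝ}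
    (hf : Continuous f) : IntegrableOn f Ω :=
  (hf.continuousOn.integrableOn_compact hΩ.isCompact_closure).mono_set subset_closure

theorem IsSmoothBoundedDomain.integrable_surfaceMeasure (hΩ : IsSmoothBoundedDomain Ω) {f : E3 → ℝ}
    (hf : ContinuousOn f (frontier Ω)) : Integrable f (surfaceMeasure Ω) := by
  have := hΩ.isFiniteMeasure_surfaceMeasure
  obtain ⟨C, hC⟩ := hΩ.isCompact_frontier.exists_bound_of_continuousOn hf
  refine Integrable.of_bound (hf.aestronglyMeasurable isClosed_frontier.measurableSet) C ?_
  exact (ae_restrict_mem isClosed_frontier.measurableSet).mono fun x hx => hC x hx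

theorem IsSmoothBoundedDomain.exists_integral_fderiv_of_inner_pos (hΩ : IsSmoothBoundedDomain Ω)
    (hp : p ∈ frontier Ω) {e : E3} (he : 0 < inner ℝ e (outwardNormal Ω p)) :
    ∃ W, IsOpen W ∧ p ∈ W ∧ ∀ φ : E3 → ℝ, ContDiff ℝ ∞ φ → tsupport φ ⊆ W →
      ∫ x in Ω, fderiv ℝ φ x e =
        ∫ x, φ x * inner ℝ e (outwardNormal Ω x) ∂(surfaceMeasure Ω) := by
  have he0 : e ≠ 0 := fun h => by rw [h, inner_zero_left] at he; exact he.false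
  have hpos : 0 < ‖e‖ := norm_pos_iff.2 he0
  obtain ⟨b, hb⟩ := exists_orthonormalBasis_two (e := ‖e‖⁻¹ • e)
    (by rw [norm_smul, norm_inv, norm_norm, inv_mul_cancel₀ hpos.ne'])
  have heb : e = ‖e‖ • b 2 := by rw [hb, smul_smul, mul_inv_cancel₀ hpos.ne', one_smul]
  have hbn : 0 < inner ℝ (b 2) (outwardNormal Ω p) := by
    rw [hb, real_inner_smul_left]; positivity
  obtain ⟨W, hWo, hpW, hW⟩ := hΩ.exists_integral_fderiv_transversal hp hbn
  refine ⟨W, hWo, hpW, fun φ hφ hs => ?_⟩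
  have := hW φ hφ hs
  rw [heb]
  simp only [map_smul, smul_eq_mul, real_inner_smul_left]
  rw [integral_const_mul, this, ← integral_const_mul]
  congr 1
  ext x
  ring

/-- Both sides are linear in the direction, and every `e` is the difference of two directions
pointing outwards at `p`, namely `e + (‖e‖ + 1) n` and `(‖e‖ + 1) n`. -/
theorem IsSmoothBoundedDomain.exists_integral_fderiv (hΩ : IsSmoothBoundedDomain Ω)
    (hp : p ∈ frontier Ω) (e : E3) :
    ∃ W, IsOpen W ∧ p ∈ W ∧ ∀ φ : E3 → ℝ, ContDiff ℝ ∞ φ → tsupport φ ⊆ W →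
      ∫ x in Ω, fderiv ℝ φ x e =
        ∫ x, φ x * inner ℝ e (outwardNormal Ω x) ∂(surfaceMeasure Ω) := by
  set n := outwardNormal Ω p with hn
  have hnn : ‖n‖ = 1 := hΩ.norm_outwardNormal hp
  have h1 : 0 < inner ℝ (e + (‖e‖ + 1) • n) n := by
    rw [inner_add_left, real_inner_smul_left, real_inner_self_eq_norm_sq, hnn]
    have := neg_le_of_abs_le (abs_real_inner_le_norm e n)
    rw [hnn] at this
    linarith
  have h2 : 0 < inner ℝ ((‖e‖ + 1) • n) n := by
    rw [real_inner_smul_left, real_inner_self_eq_norm_sq, hnn]; positivity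
  obtain ⟨W₁, hW₁o, hpW₁, hW₁⟩ := hΩ.exists_integral_fderiv_of_inner_pos hp h1
  obtain ⟨W₂, hW₂o, hpW₂, hW₂⟩ := hΩ.exists_integral_fderiv_of_inner_pos hp h2
  refine ⟨W₁ ∩ W₂, hW₁o.inter hW₂o, ⟨hpW₁, hpW₂⟩, fun φ hφ hs => ?_⟩
  have e1 := hW₁ φ hφ (hs.trans Set.inter_subset_left)
  have e2 := hW₂ φ hφ (hs.trans Set.inter_subset_right)
  have hi : ∀ v : E3, IntegrableOn (fun x => fderiv ℝ φ x v) Ω := fun v =>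
    hΩ.integrableOn ((hφ.continuous_fderiv (by simp)).clm_apply continuous_const)
  have hj : ∀ v : E3, Integrable (fun x => φ x * inner ℝ v (outwardNormal Ω x))
      (surfaceMeasure Ω) := fun v => hΩ.integrable_surfaceMeasure
    (hφ.continuous.continuousOn.mul (continuousOn_const.inner hΩ.continuousOn_outwardNormal))
  simp only [map_add, inner_add_left, mul_add] at e1
  rw [integral_add (hi _) (hi _), integral_add (hj _) (hj _), e2] at e1
  exact add_right_cancel e1

theorem integral_fderiv_eq_zero {φ : E3 → ℝ} (hφ : ContDiff ℝ ∞ φ) (hc : HasCompactSupport φ)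
    (e : E3) : ∫ x, fderiv ℝ φ x e = 0 := by
  have hcf : Continuous fun x => fderiv ℝ φ x e :=
    (hφ.continuous_fderiv (by simp)).clm_apply continuous_const
  have hi : Integrable fun x => fderiv ℝ φ x e :=
    hcf.integrable_of_hasCompactSupport (hc.fderiv_apply ℝ e)
  have := integral_mul_fderiv_eq_neg_fderiv_mul_of_integrable (μ := (volume : Measure E3))
    (f := fun _ => (1 : ℝ)) (g := φ) (v := e) (by simp) (by simpa using hi)
    (by simpa using hφ.continuous.integrable_of_hasCompactSupport hc)
    (fun _ _ => differentiableAt_const _) (fun x _ => hφ.differentiable (by simp) x)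
  simpa using this

theorem exists_finite_smooth_partition {K : Set E3} (hK : IsCompact K) {W : E3 → Set E3}
    (hW : ∀ x ∈ K, IsOpen (W x) ∧ x ∈ W x) :
    ∃ (ι : Type) (_ : Fintype ι) (c : ι → E3) (χ : ι → E3 → ℝ),
      (∀ i, c i ∈ K) ∧ (∀ i, ContDiff ℝ ∞ (χ i)) ∧ (∀ i, HasCompactSupport (χ i)) ∧
      (∀ i, tsupport (χ i) ⊆ W (c i)) ∧ ∀ x ∈ K, ∑ i, χ i x = 1 := by
  -- Intersecting with unit balls keeps the supports bounded, hence compact.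
  obtain ⟨t, htK, hKt⟩ := hK.elim_nhds_subcover (fun x => W x ∩ Metric.ball x 1) fun x hx =>
    inter_mem ((hW x hx).1.mem_nhds (hW x hx).2) (Metric.ball_mem_nhds x one_pos)
  obtain ⟨f, hf⟩ := SmoothPartitionOfUnity.exists_isSubordinate (modelWithCornersSelf ℝ E3)
    hK.isClosed (fun i : t => W i ∩ Metric.ball (i : E3) 1)
    (fun i => (hW i (htK i i.2)).1.inter Metric.isOpen_ball) (fun x hx => by
      obtain ⟨i, hi, hxi⟩ := Set.mem_iUnion₂.1 (hKt hx)
      exact Set.mem_iUnion.2 ⟨⟨i, hi⟩, hxi⟩)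
  refine ⟨t, inferInstance, Subtype.val, fun i => f i, fun i => htK i i.2,
    fun i => (f i).contMDiff.contDiff, fun i => ?_, fun i => (hf i).trans Set.inter_subset_left, ?_⟩
  · exact Metric.isCompact_of_isClosed_isBounded (isClosed_tsupport _)
      (Metric.isBounded_ball.subset ((hf i).trans Set.inter_subset_right))
  · intro x hx
    rw [← f.sum_eq_one hx, finsum_eq_sum_of_fintype]

/-- The divergence theorem. -/
theorem IsSmoothBoundedDomain.integral_fderiv (hΩ : IsSmoothBoundedDomain Ω) {φ : E3 → ℝ}
    (hφ : ContDiff ℝ ∞ φ) (e : E3) :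
    ∫ x in Ω, fderiv ℝ φ x e =
      ∫ x, φ x * inner ℝ e (outwardNormal Ω x) ∂(surfaceMeasure Ω) := by
  have hloc : ∀ p ∈ closure Ω, ∃ W, (IsOpen W ∧ p ∈ W) ∧ ∀ φ : E3 → ℝ, ContDiff ℝ ∞ φ →
      HasCompactSupport φ → tsupport φ ⊆ W → ∫ x in Ω, fderiv ℝ φ x e =
        ∫ x, φ x * inner ℝ e (outwardNormal Ω x) ∂(surfaceMeasure Ω) := by
    intro p hp
    by_cases hpΩ : p ∈ Ω
    -- For a function compactly supported in `Ω` both sides are zero.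
    · refine ⟨Ω, ⟨hΩ.isOpen, hpΩ⟩, fun φ hφ hc hs => ?_⟩
      rw [setIntegral_eq_integral_of_forall_compl_eq_zero, integral_fderiv_eq_zero hφ hc, eq_comm]
      · refine setIntegral_eq_zero_of_forall_eq_zero fun x hx => ?_
        rw [hΩ.isOpen.frontier_eq] at hx
        rw [image_eq_zero_of_notMem_tsupport fun h => hx.2 (hs h), zero_mul]
      · intro x hx
        have : fderiv ℝ φ x = 0 := by
          by_contra h
          exact hx (hs (support_fderiv_subset ℝ h))
        rw [this]; rfl
    · have hpf : p ∈ frontier Ω := by rw [hΩ.isOpen.frontier_eq]; exact ⟨hp, hpΩ⟩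
      obtain ⟨W, hWo, hpW, hW⟩ := hΩ.exists_integral_fderiv hpf e
      exact ⟨W, ⟨hWo, hpW⟩, fun φ hφ _ hs => hW φ hφ hs⟩
  choose! W hW hWφ using hloc
  obtain ⟨ι, _, c, χ, hc, hχ, hχc, hχW, hsum⟩ :=
    exists_finite_smooth_partition hΩ.isCompact_closure hW
  have hprod : ∀ i, ContDiff ℝ ∞ fun x => χ i x * φ x := fun i => (hχ i).mul hφ
  have hi : ∀ i, ∫ x in Ω, fderiv ℝ (fun x => χ i x * φ x) x e =
      ∫ x, χ i x * φ x * inner ℝ e (outwardNormal Ω x) ∂(surfaceMeasure Ω) := fun i =>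
    hWφ (c i) (hc i) _ (hprod i) (hχc i).mul_right ((tsupport_mul_subset_left).trans (hχW i))
  have hleft : ∫ x in Ω, fderiv ℝ φ x e =
      ∑ i, ∫ x in Ω, fderiv ℝ (fun x => χ i x * φ x) x e := by
    rw [← integral_finsetSum]
    · refine setIntegral_congr_fun hΩ.isOpen.measurableSet fun x hx => ?_
      have heq : φ =ᶠ[𝓝 x] fun x => ∑ i, χ i x * φ x := by
        filter_upwards [hΩ.isOpen.mem_nhds hx] with y hy
        rw [← Finset.sum_mul, hsum y (subset_closure hy), one_mul]
      rw [heq.fderiv_eq, fderiv_fun_sum fun i _ => (hprod i).differentiable (by simp) x]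
      simp
    · exact fun i _ => hΩ.integrableOn
        (((hprod i).continuous_fderiv (by simp)).clm_apply continuous_const)
  have hright : ∫ x, φ x * inner ℝ e (outwardNormal Ω x) ∂(surfaceMeasure Ω) =
      ∑ i, ∫ x, χ i x * φ x * inner ℝ e (outwardNormal Ω x) ∂(surfaceMeasure Ω) := by
    rw [← integral_finsetSum]
    · refine setIntegral_congr_fun isClosed_frontier.measurableSet fun x hx => ?_
      rw [← Finset.sum_mul, ← Finset.sum_mul, hsum x (frontier_subset_closure hx), one_mul]
    · exact fun i _ => hΩ.integrable_surfaceMeasure ((hprod i).continuous.continuousOn.mul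
        (continuousOn_const.inner hΩ.continuousOn_outwardNormal))
  rw [hleft, hright, Finset.sum_congr rfl fun i _ => hi i]

end

section

/-! ### Mollification in `L²` -/

/-- Continuity of translation in `L²`, read off from the continuous action of measure-preserving
maps on `Lp`. -/
theorem exists_eLpNorm_translate_sub_le {f : E3 → ℝ} (hf : MemLp f 2) {ε : ENNReal} (hε : 0 < ε) :
    ∃ δ > 0, ∀ t : E3, ‖t‖ < δ → eLpNorm (fun x => f (x - t) - f x) 2 ≤ ε := by
  have hmp : ∀ t : E3, MeasurePreserving (fun x : E3 => x - t) := fun t =>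
    measurePreserving_sub_right volume t
  set g : E3 → C(E3, E3) := fun t => ⟨fun x => x - t, by fun_prop⟩ with hg
  have hgc : Continuous g :=
    (ContinuousMap.curry ⟨fun z : E3 × E3 => z.2 - z.1, by fun_prop⟩).continuous
  have hgm : ∀ t, MeasurePreserving (g t) volume volume := hmp
  have hc : Continuous fun t => Lp.compMeasurePreserving (g t) (hgm t) (hf.toLp f) :=
    Continuous.compMeasurePreservingLp continuous_const hgc hgm (by simp)
  have h0 : Lp.compMeasurePreserving (g 0) (hgm 0) (hf.toLp f) = hf.toLp f := by
    rw [Lp.toLp_compMeasurePreserving hf (hgm 0)]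
    congr 1
    ext x
    simp [hg]
  have hev := (EMetric.tendsto_nhds.1 (hc.tendsto 0) ε hε)
  obtain ⟨δ, hδ, h⟩ := Metric.eventually_nhds_iff.1 hev
  refine ⟨δ, hδ, fun t ht => ?_⟩
  have := (h (y := t) (by simpa using ht)).le
  rw [h0, Lp.toLp_compMeasurePreserving hf (hgm t), Lp.edist_toLp_toLp] at this
  exact this

/-- Jensen's inequality for the probability measure with density `k`, in the form of the inclusion
of `L²` in `L¹`. -/
theorem enorm_integral_mul_sq_le {k h : E3 → ℝ} (hk : Continuous k) (hk0 : ∀ t, 0 ≤ k t)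
    (hki : Integrable k) (hk1 : ∫ t, k t = 1) (hh : AEStronglyMeasurable h) :
    ‖∫ t, k t * h t‖ₑ ^ 2 ≤ ∫⁻ t, ENNReal.ofReal (k t) * ‖h t‖ₑ ^ 2 := by
  have hkm : Measurable fun t => ENNReal.ofReal (k t) := hk.measurable.ennreal_ofReal
  set κ : Measure E3 := volume.withDensity fun t => ENNReal.ofReal (k t) with hκ
  have : IsProbabilityMeasure κ := ⟨by
    rw [hκ, withDensity_apply _ MeasurableSet.univ, setLIntegral_univ,
      ← ofReal_integral_eq_lintegral_ofReal hki (Eventually.of_forall hk0), hk1, ENNReal.ofReal_one]⟩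
  have hhκ : AEStronglyMeasurable h κ :=
    hh.mono_ac (withDensity_absolutelyContinuous _ _)
  have h1 : ‖∫ t, k t * h t‖ₑ ≤ eLpNorm h 1 κ := by
    refine (enorm_integral_le_lintegral_enorm _).trans_eq ?_
    rw [eLpNorm_one_eq_lintegral_enorm, hκ,
      lintegral_withDensity_eq_lintegral_mul₀ hkm.aemeasurable hh.enorm]
    refine lintegral_congr fun t => ?_
    rw [enorm_mul, Pi.mul_apply, Real.enorm_of_nonneg (hk0 t)]
  have h2 : eLpNorm h 1 κ ≤ eLpNorm h 2 κ :=
    eLpNorm_le_eLpNorm_of_exponent_le (by norm_num) hhκ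
  have h3 : eLpNorm h 2 κ ^ 2 = ∫⁻ t, ENNReal.ofReal (k t) * ‖h t‖ₑ ^ 2 := by
    have := eLpNorm_nnreal_pow_eq_lintegral (μ := κ) (f := h) (p := 2) (by norm_num)
    simp only [NNReal.coe_ofNat, ENNReal.coe_ofNat, ENNReal.rpow_ofNat] at this
    rw [this, hκ, lintegral_withDensity_eq_lintegral_mul₀ hkm.aemeasurable (hh.enorm.pow_const 2)]
    rfl
  rw [← h3]
  gcongr
  exact h1.trans h2

/-- By Jensen and Tonelli the squared error is at most the `k`-average of the squared translation
errors. Only smallness of the support matters, not its centring, so kernels shifted off the origin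
are allowed. -/
theorem exists_eLpNorm_convolution_sub_le {f : E3 → ℝ} (hf : MemLp f 2) {ε : ENNReal}
    (hε : 0 < ε) :
    ∃ δ > 0, ∀ k : E3 → ℝ, Continuous k → HasCompactSupport k → (∀ t, 0 ≤ k t) →
      ∫ t, k t = 1 → Function.support k ⊆ Metric.ball 0 δ →
      eLpNorm (fun x => (∫ t, k t * f (x - t)) - f x) 2 ≤ ε := by
  obtain ⟨δ, hδ, h⟩ := exists_eLpNorm_translate_sub_le hf hε
  refine ⟨δ, hδ, fun k hk hkc hk0 hk1 hks => ?_⟩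
  have hki : Integrable k := hk.integrable_of_hasCompactSupport hkc
  -- Tonelli needs joint measurability in `(x, t)`, so a measurable representative is used.
  obtain ⟨f', hf'm, hff'⟩ := hf.1
  have hf' : MemLp f' 2 := hf.ae_eq hff'
  have hqmp : ∀ x : E3, Measure.QuasiMeasurePreserving (fun t : E3 => x - t) volume volume :=
    fun x => (Measure.measurePreserving_sub_left volume x).quasiMeasurePreserving
  have hqmp' : ∀ t : E3, Measure.QuasiMeasurePreserving (fun x : E3 => x - t) volume volume :=
    fun t => (measurePreserving_sub_right volume t).quasiMeasurePreserving
  have hconv : ∀ x, ∫ t, k t * f (x - t) = ∫ t, k t * f' (x - t) := fun x => by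
    refine integral_congr_ae ?_
    filter_upwards [(hqmp x).ae_eq_comp hff'] with t ht
    simp only [Function.comp_apply] at ht
    rw [ht]
  have htr : ∀ t, ‖t‖ < δ → eLpNorm (fun x => f' (x - t) - f' x) 2 ≤ ε := fun t ht => by
    refine le_trans (le_of_eq (eLpNorm_congr_ae ?_)) (h t ht)
    filter_upwards [(hqmp' t).ae_eq_comp hff', hff'] with x h1 h2
    simp only [Function.comp_apply] at h1
    rw [h1, h2]
  have hle : eLpNorm (fun x => (∫ t, k t * f' (x - t)) - f' x) 2 ≤ ε := by
    have hsq : ∀ g : E3 → ℝ, eLpNorm g 2 ^ 2 = ∫⁻ x, ‖g x‖ₑ ^ 2 := fun g => by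
      have := eLpNorm_nnreal_pow_eq_lintegral (μ := (volume : Measure E3)) (f := g) (p := 2)
        (by norm_num)
      simpa using this
    have hpt : ∀ x, ‖(∫ t, k t * f' (x - t)) - f' x‖ₑ ^ 2 ≤
        ∫⁻ t, ENNReal.ofReal (k t) * ‖f' (x - t) - f' x‖ₑ ^ 2 := by
      intro x
      have hloc : LocallyIntegrable f' := hf'.locallyIntegrable (by norm_num)
      have hi : Integrable fun t => k t * f' (x - t) :=
        hkc.convolutionExists_left (ContinuousLinearMap.mul ℝ ℝ) hk hloc x
      have he : (∫ t, k t * f' (x - t)) - f' x = ∫ t, k t * (f' (x - t) - f' x) := by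
        simp only [mul_sub]
        rw [integral_sub hi (hki.mul_const _), integral_mul_const, hk1, one_mul]
      rw [he]
      refine enorm_integral_mul_sq_le hk hk0 hki hk1 ?_
      exact ((hf'm.measurable.comp (by fun_prop)).sub_const _).aestronglyMeasurable
    have hfin : eLpNorm (fun x => (∫ t, k t * f' (x - t)) - f' x) 2 ^ 2 ≤ ε ^ 2 := by
      rw [hsq]
      calc ∫⁻ x, ‖(∫ t, k t * f' (x - t)) - f' x‖ₑ ^ 2
          ≤ ∫⁻ x, ∫⁻ t, ENNReal.ofReal (k t) * ‖f' (x - t) - f' x‖ₑ ^ 2 := lintegral_mono hpt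
        _ = ∫⁻ t, ∫⁻ x, ENNReal.ofReal (k t) * ‖f' (x - t) - f' x‖ₑ ^ 2 := by
            refine lintegral_lintegral_swap (Measurable.aemeasurable ?_)
            have hm := hf'm.measurable
            have h1 : Measurable fun z : E3 × E3 => f' (z.1 - z.2) - f' z.1 :=
              (hm.comp (measurable_fst.sub measurable_snd)).sub (hm.comp measurable_fst)
            exact ((hk.measurable.comp measurable_snd).ennreal_ofReal).mul (h1.enorm.pow_const 2)
        _ = ∫⁻ t, ENNReal.ofReal (k t) * eLpNorm (fun x => f' (x - t) - f' x) 2 ^ 2 := by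
            refine lintegral_congr fun t => ?_
            rw [lintegral_const_mul' _ _ ENNReal.ofReal_ne_top, hsq]
        _ ≤ ∫⁻ t, ENNReal.ofReal (k t) * ε ^ 2 := by
            refine lintegral_mono fun t => ?_
            by_cases ht : k t = 0
            · simp [ht]
            · have := htr t (by simpa using hks ht)
              gcongr
        _ = ε ^ 2 := by
            rw [lintegral_mul_const _ hk.measurable.ennreal_ofReal,
              ← ofReal_integral_eq_lintegral_ofReal hki (Eventually.of_forall hk0), hk1,
              ENNReal.ofReal_one, one_mul]
    exact (ENNReal.pow_le_pow_left_iff (by norm_num)).1 hfin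
  refine le_trans (le_of_eq (eLpNorm_congr_ae ?_)) hle
  filter_upwards [hff'] with x hx
  rw [hconv x, hx]

end

section

variable {Ω : Set E3} {p : E3}

/-! ### Density of smooth functions in `H¹(Ω)` -/

/-- A uniform interior cone condition. -/
theorem IsSmoothBoundedDomain.exists_cone (hΩ : IsSmoothBoundedDomain Ω) (hp : p ∈ closure Ω) :
    ∃ W : Set E3, (IsOpen W ∧ p ∈ W) ∧ ∃ (e : E3) (c : ℝ) (τ₀ : ℝ), 0 < c ∧ 0 < τ₀ ∧
      ∀ x ∈ Ω ∩ W, ∀ τ : ℝ, 0 < τ → τ < τ₀ → Metric.closedBall (x - τ • e) (c * τ) ⊆ Ω := by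
  by_cases hpΩ : p ∈ Ω
  · obtain ⟨r, hr, hball⟩ := Metric.isOpen_iff.1 hΩ.isOpen p hpΩ
    refine ⟨Metric.ball p (r / 2), ⟨Metric.isOpen_ball, Metric.mem_ball_self (by positivity)⟩,
      0, 1, r / 2, one_pos, by positivity, ?_⟩
    rintro x ⟨-, hx⟩ τ hτ hτr z hz
    apply hball
    rw [smul_zero, sub_zero, one_mul, Metric.mem_closedBall] at hz
    rw [Metric.mem_ball] at hx ⊢
    linarith [dist_triangle z x p]
  · have hpf : p ∈ frontier Ω := by rw [hΩ.isOpen.frontier_eq]; exact ⟨hp, hpΩ⟩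
    obtain ⟨ρ, -, -, r, hr, hΩr, -, hest⟩ :=
      hΩ.exists_almost_affine hpf (ε := 1 / 4) (by norm_num) (by norm_num)
    set n := outwardNormal Ω p with hn
    have hnn : ‖n‖ = 1 := hΩ.norm_outwardNormal hpf
    refine ⟨Metric.ball p (r / 2), ⟨Metric.isOpen_ball, Metric.mem_ball_self (by positivity)⟩,
      n, 1 / 4, r / 4, by norm_num, by positivity, ?_⟩
    rintro x ⟨hxΩ, hx⟩ τ hτ hτr z hz
    rw [Metric.mem_closedBall, dist_eq_norm] at hz
    set w := z - (x - τ • n) with hw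
    have hzx : z - x = w - τ • n := by rw [hw]; abel
    have hzxn : ‖z - x‖ ≤ 5 / 4 * τ := by
      rw [hzx]
      refine (norm_sub_le _ _).trans ?_
      rw [norm_smul, hnn, Real.norm_eq_abs, abs_of_pos hτ]
      linarith
    have hxr : x ∈ Metric.ball p r := Metric.ball_subset_ball (by linarith) hx
    have hzr : z ∈ Metric.ball p r := by
      rw [Metric.mem_ball] at hx ⊢
      have h1 := dist_triangle z x p
      rw [dist_eq_norm z x] at h1
      linarith
    -- The linear part drops by at least `3τ/4`, while the error is at most `(1/4)(5τ/4) = 5τ/16`;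
    -- so `ρ` stays negative at `z`.
    have h1 := (abs_le.1 (hest z hzr x hxr)).2
    have h2 : inner ℝ n (z - x) ≤ 1 / 4 * τ - τ := by
      rw [hzx, inner_sub_right, real_inner_smul_right, real_inner_self_eq_norm_sq, hnn]
      have := real_inner_le_norm n w
      rw [hnn] at this
      linarith
    rw [hΩr z hzr]
    have h3 := (hΩr x hxr).1 hxΩ
    linarith

/-- A square-integrable scalar function `w` on `Ω` has the square-integrable weak partial
derivatives `G j`. -/
structure IsWeakGradient (Ω : Set E3) (w : E3 → ℝ) (G : Fin 3 → E3 → ℝ) : Prop where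
  memLp : MemLp w 2 (volume.restrict Ω)
  memLp_grad : ∀ j, MemLp (G j) 2 (volume.restrict Ω)
  integral_eq : ∀ φ : E3 → ℝ, ContDiff ℝ ∞ φ → HasCompactSupport φ → tsupport φ ⊆ Ω → ∀ j,
    ∫ x in Ω, w x * fderiv ℝ φ x (EuclideanSpace.single j 1) = - ∫ x in Ω, G j x * φ x

theorem MemLp.mul_continuous (hΩ : IsSmoothBoundedDomain Ω) {w : E3 → ℝ}
    (hw : MemLp w 2 (volume.restrict Ω)) {f : E3 → ℝ} (hf : Continuous f) :
    MemLp (fun x => f x * w x) 2 (volume.restrict Ω) := by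
  obtain ⟨C, hC⟩ := hΩ.isCompact_closure.exists_bound_of_continuousOn hf.continuousOn
  refine MemLp.of_le_mul (c := C) hw (hf.aestronglyMeasurable.mul hw.1) ?_
  refine (ae_restrict_mem hΩ.isOpen.measurableSet).mono fun x hx => ?_
  rw [norm_mul]
  gcongr
  exact hC x (subset_closure hx)

theorem integrable_mul_continuous (hΩ : IsSmoothBoundedDomain Ω) {w : E3 → ℝ}
    (hw : MemLp w 2 (volume.restrict Ω)) {f : E3 → ℝ} (hf : Continuous f) :
    Integrable (fun x => f x * w x) (volume.restrict Ω) := by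
  have := hΩ.isFiniteMeasure_volume
  exact (MemLp.mul_continuous hΩ hw hf).integrable (by norm_num)

/-- Extend `χ w` by zero and mollify with a kernel supported in the ball of radius `c τ` about `τ
e`. By the cone condition, the mollification at a point of `Ω ∩ W` samples only points of `Ω`, so
the jump of the extension across the boundary is never seen and differentiation commutes with
mollification on `Ω`. -/
theorem IsWeakGradient.exists_approx_cutoff (hΩ : IsSmoothBoundedDomain Ω) {w : E3 → ℝ}
    {G : Fin 3 → E3 → ℝ} (hw : IsWeakGradient Ω w G) {W : Set E3} (hWo : IsOpen W) {e : E3}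
    {c τ₀ : ℝ} (hc : 0 < c) (hτ₀ : 0 < τ₀)
    (hcone : ∀ x ∈ Ω ∩ W, ∀ τ : ℝ, 0 < τ → τ < τ₀ → Metric.closedBall (x - τ • e) (c * τ) ⊆ Ω)
    {χ : E3 → ℝ} (hχ : ContDiff ℝ ∞ χ) (hχc : HasCompactSupport χ) (hχW : tsupport χ ⊆ W)
    {ε : ENNReal} (hε : 0 < ε) :
    ∃ v : E3 → ℝ, ContDiff ℝ ∞ v ∧
      eLpNorm (fun x => v x - χ x * w x) 2 (volume.restrict Ω) ≤ ε ∧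
      ∀ j, eLpNorm (fun x => fderiv ℝ v x (EuclideanSpace.single j 1) -
        (χ x * G j x + fderiv ℝ χ x (EuclideanSpace.single j 1) * w x)) 2 (volume.restrict Ω) ≤ ε := by
  have hΩm : MeasurableSet Ω := hΩ.isOpen.measurableSet
  have hdχ : ∀ j : Fin 3, Continuous fun x => fderiv ℝ χ x (EuclideanSpace.single j 1) := fun j =>
    (hχ.continuous_fderiv (by simp)).clm_apply continuous_const
  set f : E3 → ℝ := Ω.indicator fun x => χ x * w x with hf
  set h : Fin 3 → E3 → ℝ := fun j => Ω.indicator fun x =>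
    χ x * G j x + fderiv ℝ χ x (EuclideanSpace.single j 1) * w x with hh
  have hfL : MemLp f 2 := (memLp_indicator_iff_restrict hΩm).2
    (MemLp.mul_continuous hΩ hw.memLp hχ.continuous)
  have hhL : ∀ j, MemLp (h j) 2 := fun j => (memLp_indicator_iff_restrict hΩm).2
    ((MemLp.mul_continuous hΩ (hw.memLp_grad j) hχ.continuous).add
      (MemLp.mul_continuous hΩ hw.memLp (hdχ j)))
  obtain ⟨δ, hδ, hδf⟩ := exists_eLpNorm_convolution_sub_le hfL hε
  choose δ' hδ' hδh using fun j => exists_eLpNorm_convolution_sub_le (hhL j) hε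
  -- A point `x` whose sampling ball meets the support of `χ` lies within `d` of it, hence in `W`,
  -- where the cone condition applies.
  obtain ⟨d, hd, hdW⟩ := IsCompact.exists_cthickening_subset_open hχc hWo hχW
  obtain ⟨τ, hτ0, hττ₀, hτδ, hτδ', hτd⟩ : ∃ τ : ℝ, 0 < τ ∧ τ < τ₀ ∧ τ * (‖e‖ + c) < δ ∧
      (∀ j, τ * (‖e‖ + c) < δ' j) ∧ τ * (‖e‖ + c) < d := by
    have hlim : Tendsto (fun τ : ℝ => τ * (‖e‖ + c)) (𝓝[>] 0) (𝓝 0) := by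
      have : Continuous fun τ : ℝ => τ * (‖e‖ + c) := by fun_prop
      simpa using (this.tendsto 0).mono_left nhdsWithin_le_nhds
    have h1 : ∀ᶠ τ : ℝ in 𝓝[>] 0, 0 < τ := self_mem_nhdsWithin
    have h2 : ∀ᶠ τ : ℝ in 𝓝[>] 0, τ < τ₀ := nhdsWithin_le_nhds (gt_mem_nhds hτ₀)
    have h3 : ∀ᶠ τ : ℝ in 𝓝[>] 0, ∀ j, τ * (‖e‖ + c) < δ' j :=
      eventually_all.2 fun j => hlim.eventually (gt_mem_nhds (hδ' j))
    obtain ⟨τ, h⟩ := (h1.and (h2.and ((hlim.eventually (gt_mem_nhds hδ)).and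
      (h3.and (hlim.eventually (gt_mem_nhds hd)))))).exists
    exact ⟨τ, h.1, h.2.1, h.2.2.1, h.2.2.2.1, h.2.2.2.2⟩
  let β : ContDiffBump (τ • e) := ⟨c * τ / 2, c * τ, by positivity, by nlinarith [mul_pos hc hτ0]⟩
  set k : E3 → ℝ := β.normed volume with hk
  have hkC : ContDiff ℝ ∞ k := β.contDiff_normed
  have hkc : HasCompactSupport k := β.hasCompactSupport_normed
  have hk0 : ∀ t, 0 ≤ k t := fun t => β.nonneg_normed t
  have hk1 : ∫ t, k t = 1 := β.integral_normed
  have hkts : tsupport k = Metric.closedBall (τ • e) (c * τ) := β.tsupport_normed_eq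
  have hksmall : ∀ t ∈ Metric.closedBall (τ • e) (c * τ), ‖t‖ ≤ τ * (‖e‖ + c) := by
    intro t ht
    rw [Metric.mem_closedBall, dist_eq_norm] at ht
    have : ‖t‖ ≤ ‖t - τ • e‖ + ‖τ • e‖ := by
      simpa using norm_add_le (t - τ • e) (τ • e)
    rw [norm_smul, Real.norm_eq_abs, abs_of_pos hτ0] at this
    linarith
  have hks : ∀ δ, τ * (‖e‖ + c) < δ → Function.support k ⊆ Metric.ball 0 δ := fun δ hδ t ht => by
    have := hksmall t (hkts ▸ subset_tsupport k ht)
    rw [mem_ball_zero_iff]; linarith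
  have hfloc : LocallyIntegrable f := hfL.locallyIntegrable (by norm_num)
  have hvC := hkc.contDiff_convolution_left (ContinuousLinearMap.mul ℝ ℝ) hkC hfloc
    (μ := volume)
  refine ⟨fun x => ∫ t, k t * f (x - t), hvC, ?_, fun j => ?_⟩
  · refine le_trans (le_of_eq (eLpNorm_congr_ae ?_)) ((eLpNorm_mono_measure _
      Measure.restrict_le_self).trans (hδf k hkC.continuous hkc hk0 hk1 (hks δ hτδ)))
    refine (ae_restrict_mem hΩm).mono fun x hx => ?_
    simp only [hf, Set.indicator_of_mem hx]
  refine le_trans (le_of_eq (eLpNorm_congr_ae ?_)) ((eLpNorm_mono_measure _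
    Measure.restrict_le_self).trans (hδh j k hkC.continuous hkc hk0 hk1 (hks _ (hτδ' j))))
  refine (ae_restrict_mem hΩm).mono fun x hx => ?_
  simp only [hh, Set.indicator_of_mem hx]
  congr 1
  set ej : E3 := EuclideanSpace.single j 1 with hej
  have hdk : Continuous fun x => fderiv ℝ k x ej :=
    (hkC.continuous_fderiv (by simp)).clm_apply continuous_const
  -- the derivative of the convolution falls on the kernel
  have hder : fderiv ℝ (fun x => ∫ t, k t * f (x - t)) x ej = ∫ t, fderiv ℝ k t ej * f (x - t) := by
    have hfd := hkc.hasFDerivAt_convolution_left (ContinuousLinearMap.mul ℝ ℝ)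
      (hkC.of_le (by simp)) hfloc (μ := volume) x
    have hex := (hkc.fderiv ℝ).convolutionExists_left
      ((ContinuousLinearMap.mul ℝ ℝ).precompL E3) (hkC.continuous_fderiv (by simp)) hfloc x
    have h1 := hfd.fderiv
    have h2 : fderiv ℝ (fun x => ∫ t, k t * f (x - t)) x =
      ∫ t, (ContinuousLinearMap.mul ℝ ℝ).precompL E3 (fderiv ℝ k t) (f (x - t)) := h1
    rw [h2, ContinuousLinearMap.integral_apply hex]
    rfl
  rw [hder]
  -- The test function for the weak derivative: its support lies in `Ω` because of the shift, and it
  -- is empty unless `x ∈ W`.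
  set φ : E3 → ℝ := fun z => k (x - z) * χ z with hφ
  have hkx : ContDiff ℝ ∞ fun z => k (x - z) := hkC.comp (contDiff_const.sub contDiff_id)
  have hφC : ContDiff ℝ ∞ φ := hkx.mul hχ
  have hφc : HasCompactSupport φ := hχc.mul_left
  have hφs : tsupport φ ⊆ Ω := by
    intro z hz
    have hzχ : z ∈ tsupport χ := tsupport_mul_subset_right hz
    have hzk : z ∈ Metric.closedBall (x - τ • e) (c * τ) := by
      have hsub : tsupport φ ⊆ Metric.closedBall (x - τ • e) (c * τ) := by
        refine closure_minimal (fun z hz => ?_) Metric.isClosed_closedBall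
        have : k (x - z) ≠ 0 := fun h0 => hz (by simp [hφ, h0])
        have := subset_tsupport k this
        rw [hkts, Metric.mem_closedBall, dist_eq_norm] at this
        rw [Metric.mem_closedBall, dist_eq_norm, ← norm_neg]
        rwa [show -(z - (x - τ • e)) = x - z - τ • e by abel]
      exact hsub hz
    have hxW : x ∈ W := by
      apply hdW
      refine Metric.mem_cthickening_of_dist_le x z d _ hzχ ?_
      rw [dist_eq_norm]
      refine (hksmall (x - z) ?_).trans hτd.le
      rw [Metric.mem_closedBall, dist_eq_norm] at hzk ⊢
      rwa [← norm_neg, show -(x - z - τ • e) = z - (x - τ • e) by abel]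
    exact hcone x ⟨hx, hxW⟩ τ hτ0 hττ₀ hzk
  have hφder : ∀ z, fderiv ℝ φ z ej =
      k (x - z) * fderiv ℝ χ z ej - fderiv ℝ k (x - z) ej * χ z := by
    intro z
    have h1 : HasFDerivAt (fun z => k (x - z)) ((fderiv ℝ k (x - z)).comp (-ContinuousLinearMap.id ℝ E3)) z := by
      have h2 : HasFDerivAt (fun z : E3 => x - z) (-ContinuousLinearMap.id ℝ E3) z :=
        (hasFDerivAt_id z).const_sub x
      exact (hkC.differentiable (by simp) (x - z)).hasFDerivAt.comp z h2
    have h3 := (h1.mul (hχ.differentiable (by simp) z).hasFDerivAt).fderiv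
    have h4 : fderiv ℝ φ z = _ := h3
    rw [h4]
    simp
    ring
  have hweak := hw.integral_eq φ hφC hφc hφs j
  have hI1 : Integrable (fun z => k (x - z) * fderiv ℝ χ z ej * w z) (volume.restrict Ω) :=
    integrable_mul_continuous hΩ hw.memLp (hkx.continuous.mul (hdχ j))
  have hI2 : Integrable (fun z => fderiv ℝ k (x - z) ej * χ z * w z) (volume.restrict Ω) :=
    integrable_mul_continuous hΩ hw.memLp
      ((hdk.comp (continuous_const.sub continuous_id)).mul hχ.continuous)
  have hI3 : Integrable (fun z => φ z * G j z) (volume.restrict Ω) :=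
    integrable_mul_continuous hΩ (hw.memLp_grad j) hφC.continuous
  have hsplit : ∫ z in Ω, w z * fderiv ℝ φ z ej =
      (∫ z in Ω, k (x - z) * fderiv ℝ χ z ej * w z) -
        ∫ z in Ω, fderiv ℝ k (x - z) ej * χ z * w z := by
    rw [← integral_sub hI1 hI2]
    refine integral_congr_ae (Eventually.of_forall fun z => ?_)
    simp only [hφder]
    ring
  have hL : ∫ t, fderiv ℝ k t ej * f (x - t) = ∫ z in Ω, fderiv ℝ k (x - z) ej * χ z * w z := by
    rw [← integral_sub_left_eq_self _ volume x, ← integral_indicator hΩm]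
    refine integral_congr_ae (Eventually.of_forall fun z => ?_)
    by_cases hz : z ∈ Ω <;> simp [hf, hz, mul_assoc]
  have hR : ∫ t, k t * (h j) (x - t) =
      (∫ z in Ω, k (x - z) * fderiv ℝ χ z ej * w z) + ∫ z in Ω, φ z * G j z := by
    rw [← integral_sub_left_eq_self _ volume x, ← integral_add hI1 hI3, ← integral_indicator hΩm]
    refine integral_congr_ae (Eventually.of_forall fun z => ?_)
    by_cases hz : z ∈ Ω
    · simp only [hh, sub_sub_cancel, Set.indicator_of_mem hz, hφ]; ring
    · simp [hh, hz]
  have hcomm : ∫ z in Ω, G j z * φ z = ∫ z in Ω, φ z * G j z := by simp only [mul_comm]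
  rw [hsplit, hcomm] at hweak
  rw [hL]
  refine Eq.trans ?_ hR.symm
  linarith

end

section

variable {Ω : Set E3} {p : E3}

theorem continuous_fderiv_apply {v : E3 → ℝ} (hv : ContDiff ℝ ∞ v) (e : E3) :
    Continuous fun x => fderiv ℝ v x e :=
  (hv.continuous_fderiv (by simp)).clm_apply continuous_const

theorem inner_single_one (j : Fin 3) (x : E3) : inner ℝ (EuclideanSpace.single j 1) x = x j := by
  simp [EuclideanSpace.inner_single_left]

theorem inner_eq_sum (x y : E3) : inner ℝ x y = ∑ j, x j * y j := by
  simp [PiLp.inner_apply, mul_comm]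

/-- Smooth functions are dense in `H¹(Ω)`. -/
theorem IsWeakGradient.exists_approx (hΩ : IsSmoothBoundedDomain Ω) {w : E3 → ℝ}
    {G : Fin 3 → E3 → ℝ} (hw : IsWeakGradient Ω w G) {ε : ENNReal} (hε : 0 < ε) :
    ∃ v : E3 → ℝ, ContDiff ℝ ∞ v ∧
      eLpNorm (fun x => v x - w x) 2 (volume.restrict Ω) ≤ ε ∧
      ∀ j, eLpNorm (fun x => fderiv ℝ v x (EuclideanSpace.single j 1) - G j x) 2
        (volume.restrict Ω) ≤ ε := by
  have hcone := fun p (hp : p ∈ closure Ω) => hΩ.exists_cone hp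
  choose! W hW e c τ₀ hc hτ₀ hcone using hcone
  obtain ⟨ι, _, q, χ, hq, hχ, hχc, hχW, hsum⟩ :=
    exists_finite_smooth_partition hΩ.isCompact_closure hW
  -- The extra one keeps `N` nonzero even for an empty partition.
  set N : ENNReal := Fintype.card ι + 1 with hN
  have hN0 : N ≠ 0 := by simp [hN]
  have hNt : N ≠ ⊤ := by simp [hN]
  have hε' : 0 < ε / N := ENNReal.div_pos hε.ne' hNt
  choose v hvC hv hdv using fun i => hw.exists_approx_cutoff hΩ (hW _ (hq i)).1 (hc _ (hq i))
    (hτ₀ _ (hq i)) (hcone _ (hq i)) (hχ i) (hχc i) (hχW i) hε'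
  have hbound : ∀ a : ι → ENNReal, (∀ i, a i ≤ ε / N) → ∑ i, a i ≤ ε := fun a ha => by
    calc ∑ i, a i ≤ ∑ _i : ι, ε / N := Finset.sum_le_sum fun i _ => ha i
      _ = Fintype.card ι * (ε / N) := by simp
      _ ≤ N * (ε / N) := by gcongr; exact le_self_add
      _ = ε := ENNReal.mul_div_cancel hN0 hNt
  have hΩm : MeasurableSet Ω := hΩ.isOpen.measurableSet
  refine ⟨fun x => ∑ i, v i x, ContDiff.sum fun i _ => hvC i, ?_, fun j => ?_⟩
  · refine le_trans (le_of_eq (eLpNorm_congr_ae ?_)) ((eLpNorm_sum_le (s := Finset.univ)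
      (f := fun i x => v i x - χ i x * w x) (fun i _ => ?_) (by norm_num)).trans
        (hbound _ fun i => hv i))
    · refine (ae_restrict_mem hΩm).mono fun x hx => ?_
      simp only [Finset.sum_apply, Finset.sum_sub_distrib, ← Finset.sum_mul,
        hsum x (subset_closure hx), one_mul]
    · exact (hvC i).continuous.aestronglyMeasurable.sub
        ((hχ i).continuous.aestronglyMeasurable.mul hw.memLp.1)
  · set ej : E3 := EuclideanSpace.single j 1 with hej
    refine le_trans (le_of_eq (eLpNorm_congr_ae ?_)) ((eLpNorm_sum_le (s := Finset.univ)
      (f := fun i x => fderiv ℝ (v i) x ej - (χ i x * G j x + fderiv ℝ (χ i) x ej * w x))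
      (fun i _ => ?_) (by norm_num)).trans (hbound _ fun i => hdv i j))
    · refine (ae_restrict_mem hΩm).mono fun x hx => ?_
      -- The commutator terms `(∂ⱼ χᵢ) w` cancel in the sum, since the cutoffs add up to one on the
      -- open set `Ω`.
      have h1 : ∑ i, fderiv ℝ (χ i) x ej = 0 := by
        have heq : (fun x => ∑ i, χ i x) =ᶠ[𝓝 x] fun _ => (1 : ℝ) := by
          filter_upwards [hΩ.isOpen.mem_nhds hx] with y hy using hsum y (subset_closure hy)
        have := heq.fderiv_eq (𝕜 := ℝ)
        rw [fderiv_fun_sum fun i _ => (hχ i).differentiable (by simp) x, fderiv_fun_const] at this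
        have := congrArg (fun L : E3 →L[ℝ] ℝ => L ej) this
        simpa using this
      simp only [Finset.sum_apply, Finset.sum_sub_distrib, Finset.sum_add_distrib,
        ← Finset.sum_mul, hsum x (subset_closure hx), one_mul, h1, zero_mul, add_zero]
      rw [fderiv_fun_sum fun i _ => (hvC i).differentiable (by simp) x]
      simp
    · exact (continuous_fderiv_apply (hvC i) ej).aestronglyMeasurable.sub
        (((hχ i).continuous.aestronglyMeasurable.mul (hw.memLp_grad j).1).add
        ((continuous_fderiv_apply (hχ i) ej).aestronglyMeasurable.mul hw.memLp.1))

/-! ### The trace inequality and the existence of traces -/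

/-- The condition on the value at each `x` is convex, and near `p` the constant vector `n(p)`
satisfies it, so a partition of unity glues. A smooth substitute for the normal is needed because
the normal itself is controlled only on the boundary. -/
theorem IsSmoothBoundedDomain.exists_smooth_transversal (hΩ : IsSmoothBoundedDomain Ω) :
    ∃ X : E3 → E3, ContDiff ℝ ∞ X ∧
      ∀ x ∈ frontier Ω, 1 / 2 < inner ℝ (X x) (outwardNormal Ω x) := by
  obtain ⟨X, hX⟩ := exists_contMDiffMap_forall_mem_convex_of_local_const
    (modelWithCornersSelf ℝ E3) (n := ⊤)
    (t := fun x => {v : E3 | x ∈ frontier Ω → 1 / 2 < inner ℝ v (outwardNormal Ω x)})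
    (fun x v hv w hw a b ha hb hab hx => by
      have h1 := hv hx
      have h2 := hw hx
      rw [inner_add_left, real_inner_smul_left, real_inner_smul_left]
      rcases ha.eq_or_lt with rfl | ha
      · obtain rfl : b = 1 := by linarith
        linarith
      · nlinarith [mul_lt_mul_of_pos_left h1 ha, mul_le_mul_of_nonneg_left h2.le hb])
    (fun p => by
      by_cases hp : p ∈ frontier Ω
      · refine ⟨outwardNormal Ω p, ?_⟩
        have hcont : ContinuousWithinAt (fun z => inner ℝ (outwardNormal Ω p) (outwardNormal Ω z))
            (frontier Ω) p := continuousWithinAt_const.inner (hΩ.continuousOn_outwardNormal p hp)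
        have := hcont.eventually (lt_mem_nhds (a := 1 / 2)
          (by simp only; rw [real_inner_self_eq_norm_sq, hΩ.norm_outwardNormal hp]; norm_num))
        rw [eventually_nhdsWithin_iff] at this
        exact this
      · refine ⟨0, ?_⟩
        filter_upwards [isClosed_frontier.isOpen_compl.mem_nhds hp] with x hx hx'
        exact absurd hx' hx)
  exact ⟨X, X.contMDiff.contDiff, hX⟩

theorem eLpNorm_two_sq (μ : Measure E3) {f : E3 → ℝ} (hf : Integrable (fun x => f x ^ 2) μ) :
    eLpNorm f 2 μ ^ 2 = ENNReal.ofReal (∫ x, f x ^ 2 ∂μ) := by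
  have := eLpNorm_nnreal_pow_eq_lintegral (μ := μ) (f := f) (p := 2) (by norm_num)
  simp only [NNReal.coe_ofNat, ENNReal.coe_ofNat, ENNReal.rpow_ofNat] at this
  rw [this, ofReal_integral_eq_lintegral_ofReal hf (Eventually.of_forall fun x => sq_nonneg _)]
  refine lintegral_congr fun x => ?_
  rw [← Real.enorm_of_nonneg (sq_nonneg (f x)), enorm_pow]

/-- Apply the divergence theorem to `v² X` with `X` transversal: the flux dominates half the
boundary integral of `v²`, and the divergence is bounded by `v²` and `|∇v|²`. -/
theorem IsSmoothBoundedDomain.exists_trace_inequality (hΩ : IsSmoothBoundedDomain Ω) :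
    ∃ K : NNReal, ∀ v : E3 → ℝ, ContDiff ℝ ∞ v →
      eLpNorm v 2 (surfaceMeasure Ω) ≤ K * (eLpNorm v 2 (volume.restrict Ω) +
        ∑ j, eLpNorm (fun x => fderiv ℝ v x (EuclideanSpace.single j 1)) 2 (volume.restrict Ω)) := by
  obtain ⟨X, hX, hXn⟩ := hΩ.exists_smooth_transversal
  have hXj : ∀ j, ContDiff ℝ ∞ fun x => X x j := fun j => contDiff_euclidean.1 hX j
  have hΩm : MeasurableSet Ω := hΩ.isOpen.measurableSet
  choose A hA using fun j => hΩ.isCompact_closure.exists_bound_of_continuousOn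
    (hXj j).continuous.continuousOn
  choose B hB using fun j => hΩ.isCompact_closure.exists_bound_of_continuousOn
    (continuous_fderiv_apply (hXj j) (EuclideanSpace.single j 1)).continuousOn
  set M : ℝ := 1 + ∑ j, (|A j| + |B j|) with hM
  have hsumle : ∀ j, |A j| + |B j| ≤ ∑ j, (|A j| + |B j|) := fun j =>
    Finset.single_le_sum (f := fun j => |A j| + |B j|) (fun i _ => by positivity) (Finset.mem_univ j)
  have hMA : ∀ j, ∀ x ∈ Ω, |X x j| ≤ M := fun j x hx => by
    have h1 := hA j x (subset_closure hx)
    have h2 := hsumle j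
    rw [Real.norm_eq_abs] at h1
    linarith [le_abs_self (A j), abs_nonneg (B j)]
  have hMB : ∀ j, ∀ x ∈ Ω, |fderiv ℝ (fun x => X x j) x (EuclideanSpace.single j 1)| ≤ M :=
    fun j x hx => by
      have h1 := hB j x (subset_closure hx)
      have h2 := hsumle j
      rw [Real.norm_eq_abs] at h1
      linarith [le_abs_self (B j), abs_nonneg (A j)]
  have hM1 : 1 ≤ M := le_add_of_nonneg_right (Finset.sum_nonneg fun j _ => by positivity)
  -- Each of the three coordinates contributes `2M ∫ v²` and `M ∫ (∂ⱼv)²`, and the factor `1/2` on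
  -- the left doubles this. Being at least one, `12 M` may be replaced by its square when roots are
  -- taken.
  refine ⟨(12 * M).toNNReal, fun v hv => ?_⟩
  set D : Fin 3 → E3 → ℝ := fun j x => fderiv ℝ v x (EuclideanSpace.single j 1) with hD
  have hDc : ∀ j, Continuous (D j) := fun j => continuous_fderiv_apply hv _
  have hvc := hv.continuous
  have hI0 : IntegrableOn (fun x => v x ^ 2) Ω := hΩ.integrableOn (by fun_prop)
  have hIj : ∀ j, IntegrableOn (fun x => D j x ^ 2) Ω := fun j => hΩ.integrableOn (by fun_prop)
  have hIS : Integrable (fun x => v x ^ 2) (surfaceMeasure Ω) :=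
    hΩ.integrable_surfaceMeasure (by fun_prop)
  have hprod : ∀ j, ContDiff ℝ ∞ fun x => v x ^ 2 * X x j := fun j => (hv.pow 2).mul (hXj j)
  have hreal : ∫ x, v x ^ 2 ∂(surfaceMeasure Ω) ≤
      12 * M * ((∫ x in Ω, v x ^ 2) + ∑ j, ∫ x in Ω, D j x ^ 2) := by
    have hcn : ContinuousOn (fun x => v x ^ 2 * inner ℝ (X x) (outwardNormal Ω x)) (frontier Ω) :=
      (hvc.pow 2).continuousOn.mul (hX.continuous.continuousOn.inner hΩ.continuousOn_outwardNormal)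
    have h1 : 1 / 2 * ∫ x, v x ^ 2 ∂(surfaceMeasure Ω) ≤
        ∫ x, v x ^ 2 * inner ℝ (X x) (outwardNormal Ω x) ∂(surfaceMeasure Ω) := by
      rw [← integral_const_mul]
      refine integral_mono_ae (hIS.const_mul _) (hΩ.integrable_surfaceMeasure hcn) ?_
      refine (ae_restrict_mem isClosed_frontier.measurableSet).mono fun x hx => ?_
      simp only
      nlinarith [sq_nonneg (v x), hXn x hx]
    have h2 : ∫ x, v x ^ 2 * inner ℝ (X x) (outwardNormal Ω x) ∂(surfaceMeasure Ω) =
        ∑ j, ∫ x in Ω, fderiv ℝ (fun x => v x ^ 2 * X x j) x (EuclideanSpace.single j 1) := by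
      rw [Finset.sum_congr rfl fun j _ => hΩ.integral_fderiv (hprod j) _, ← integral_finsetSum]
      · refine integral_congr_ae (Eventually.of_forall fun x => ?_)
        simp only [inner_single_one, inner_eq_sum (X x), Finset.mul_sum]
        refine Finset.sum_congr rfl fun j _ => by ring
      · exact fun j _ => hΩ.integrable_surfaceMeasure ((hprod j).continuous.continuousOn.mul
          (continuousOn_const.inner hΩ.continuousOn_outwardNormal))
    have h3 : ∀ j, ∫ x in Ω, fderiv ℝ (fun x => v x ^ 2 * X x j) x (EuclideanSpace.single j 1) ≤
        2 * M * (∫ x in Ω, v x ^ 2) + M * ∫ x in Ω, D j x ^ 2 := by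
      intro j
      rw [← integral_const_mul, ← integral_const_mul,
        ← integral_add (hI0.const_mul _) ((hIj j).const_mul _)]
      refine setIntegral_mono_on (hΩ.integrableOn (continuous_fderiv_apply (hprod j) _))
        ((hI0.const_mul _).add ((hIj j).const_mul _)) hΩm fun x hx => ?_
      have hd : fderiv ℝ (fun x => v x ^ 2 * X x j) x (EuclideanSpace.single j 1) =
          v x ^ 2 * fderiv ℝ (fun x => X x j) x (EuclideanSpace.single j 1) +
            2 * v x * D j x * X x j := by
        have e1 := ((hv.differentiable (by simp) x).hasFDerivAt.pow 2).mul
          ((hXj j).differentiable (by simp) x).hasFDerivAt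
        have e2 : fderiv ℝ (fun x => v x ^ 2 * X x j) x = _ := e1.fderiv
        rw [e2]
        simp [hD]
        ring
      rw [hd]
      have hA' := hMA j x hx
      have hB' := hMB j x hx
      have e1 : v x ^ 2 * fderiv ℝ (fun x => X x j) x (EuclideanSpace.single j 1) ≤ v x ^ 2 * M :=
        mul_le_mul_of_nonneg_left ((le_abs_self _).trans hB') (sq_nonneg _)
      have e2 : 2 * v x * D j x * X x j ≤ (v x ^ 2 + D j x ^ 2) * M := by
        calc 2 * v x * D j x * X x j ≤ |2 * v x * D j x| * |X x j| := by
              rw [← abs_mul]; exact le_abs_self _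
          _ ≤ (v x ^ 2 + D j x ^ 2) * M := by
              gcongr
              rw [abs_le]
              constructor <;> nlinarith [sq_nonneg (v x + D j x), sq_nonneg (v x - D j x)]
      linarith
    have h4 := Finset.sum_le_sum fun j (_ : j ∈ Finset.univ) => h3 j
    rw [← h2, Finset.sum_add_distrib, ← Finset.mul_sum, ← Finset.mul_sum] at h4
    simp only [Finset.sum_const, Finset.card_univ, Fintype.card_fin, nsmul_eq_mul] at h4
    have hD0 : 0 ≤ ∑ j, ∫ x in Ω, D j x ^ 2 :=
      Finset.sum_nonneg fun j _ => integral_nonneg fun x => sq_nonneg _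
    have hMD := mul_nonneg (by linarith : 0 ≤ M) hD0
    push_cast at h4
    linarith
  have hK : (1 : ENNReal) ≤ ((12 * M).toNNReal : ENNReal) := by
    rw [← ENNReal.ofReal, ENNReal.one_le_ofReal]; linarith
  rw [← ENNReal.pow_le_pow_left_iff (two_ne_zero), eLpNorm_two_sq _ hIS, mul_pow]
  calc ENNReal.ofReal (∫ x, v x ^ 2 ∂(surfaceMeasure Ω))
      ≤ ENNReal.ofReal (12 * M * ((∫ x in Ω, v x ^ 2) + ∑ j, ∫ x in Ω, D j x ^ 2)) :=
        ENNReal.ofReal_le_ofReal hreal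
    _ = ((12 * M).toNNReal : ENNReal) * (eLpNorm v 2 (volume.restrict Ω) ^ 2 +
          ∑ j, eLpNorm (D j) 2 (volume.restrict Ω) ^ 2) := by
        rw [ENNReal.ofReal_mul (by positivity), ENNReal.ofReal_add
          (integral_nonneg fun x => sq_nonneg _)
          (Finset.sum_nonneg fun j _ => integral_nonneg fun x => sq_nonneg _),
          ENNReal.ofReal_sum_of_nonneg fun j _ => integral_nonneg fun x => sq_nonneg _,
          eLpNorm_two_sq _ hI0, Finset.sum_congr rfl fun j _ => eLpNorm_two_sq _ (hIj j)]
        rfl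
    _ ≤ ((12 * M).toNNReal : ENNReal) ^ 2 * (eLpNorm v 2 (volume.restrict Ω) +
          ∑ j, eLpNorm (D j) 2 (volume.restrict Ω)) ^ 2 := by
        gcongr
        · exact le_self_pow hK (by norm_num)
        · rw [Fin.sum_univ_three, Fin.sum_univ_three]
          generalize eLpNorm v 2 (volume.restrict Ω) = a
          generalize eLpNorm (D 0) 2 (volume.restrict Ω) = a0
          generalize eLpNorm (D 1) 2 (volume.restrict Ω) = a1
          generalize eLpNorm (D 2) 2 (volume.restrict Ω) = a2
          have : (a + (a0 + a1 + a2)) ^ 2 = a ^ 2 + (a0 ^ 2 + a1 ^ 2 + a2 ^ 2) +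
              2 * (a * a0 + a * a1 + a * a2 + a0 * a1 + a0 * a2 + a1 * a2) := by ring
          rw [this]
          exact le_self_add

end

section

variable {Ω : Set E3} {p : E3}

theorem IsSmoothBoundedDomain.memLp_of_continuous (hΩ : IsSmoothBoundedDomain Ω) {f : E3 → ℝ}
    (hf : Continuous f) : MemLp f 2 (volume.restrict Ω) := by
  have := hΩ.isFiniteMeasure_volume
  simpa using MemLp.mul_continuous hΩ (memLp_const (1 : ℝ)) hf

theorem IsSmoothBoundedDomain.memLp_surfaceMeasure (hΩ : IsSmoothBoundedDomain Ω) {f : E3 → ℝ}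
    (hf : ContinuousOn f (frontier Ω)) : MemLp f 2 (surfaceMeasure Ω) := by
  have := hΩ.isFiniteMeasure_surfaceMeasure
  obtain ⟨C, hC⟩ := hΩ.isCompact_frontier.exists_bound_of_continuousOn hf
  refine MemLp.of_bound (hf.aestronglyMeasurable isClosed_frontier.measurableSet) C ?_
  exact (ae_restrict_mem isClosed_frontier.measurableSet).mono fun x hx => hC x hx

/-- The trace inequality applied to differences makes an approximating sequence in `H¹` Cauchy in
`L²(∂Ω)`, and completeness supplies the limit. -/
theorem IsWeakGradient.exists_trace (hΩ : IsSmoothBoundedDomain Ω) {w : E3 → ℝ}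
    {G : Fin 3 → E3 → ℝ} (hw : IsWeakGradient Ω w G) :
    ∃ (v : ℕ → E3 → ℝ) (g : E3 → ℝ), (∀ k, ContDiff ℝ ∞ (v k)) ∧
      Tendsto (fun k => eLpNorm (fun x => v k x - w x) 2 (volume.restrict Ω)) atTop (𝓝 0) ∧
      (∀ j, Tendsto (fun k => eLpNorm (fun x => fderiv ℝ (v k) x (EuclideanSpace.single j 1) - G j x)
        2 (volume.restrict Ω)) atTop (𝓝 0)) ∧
      MemLp g 2 (surfaceMeasure Ω) ∧
      Tendsto (fun k => eLpNorm (fun x => v k x - g x) 2 (surfaceMeasure Ω)) atTop (𝓝 0) := by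
  have hpos : ∀ k : ℕ, (0 : ENNReal) < ((k : ENNReal) + 1)⁻¹ := fun k => by simp
  have hlim : Tendsto (fun k : ℕ => ((k : ENNReal) + 1)⁻¹) atTop (𝓝 0) := by
    have := (tendsto_add_atTop_iff_nat 1).2 ENNReal.tendsto_inv_nat_nhds_zero
    simpa using this
  choose v hvC hv hdv using fun k => hw.exists_approx hΩ (hpos k)
  have hv0 : Tendsto (fun k => eLpNorm (fun x => v k x - w x) 2 (volume.restrict Ω)) atTop (𝓝 0) :=
    tendsto_of_tendsto_of_tendsto_of_le_of_le tendsto_const_nhds hlim (fun _ => zero_le) hv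
  have hd0 : ∀ j, Tendsto (fun k => eLpNorm
      (fun x => fderiv ℝ (v k) x (EuclideanSpace.single j 1) - G j x) 2 (volume.restrict Ω))
      atTop (𝓝 0) := fun j =>
    tendsto_of_tendsto_of_tendsto_of_le_of_le tendsto_const_nhds hlim (fun _ => zero_le)
      fun k => hdv k j
  obtain ⟨K, hK⟩ := hΩ.exists_trace_inequality
  have hvS : ∀ k, MemLp (v k) 2 (surfaceMeasure Ω) := fun k =>
    hΩ.memLp_surfaceMeasure (hvC k).continuous.continuousOn
  set B : ℕ → ENNReal := fun k => K * (eLpNorm (fun x => v k x - w x) 2 (volume.restrict Ω) +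
    ∑ j, eLpNorm (fun x => fderiv ℝ (v k) x (EuclideanSpace.single j 1) - G j x) 2
      (volume.restrict Ω)) with hB
  have hB0 : Tendsto B atTop (𝓝 0) := by
    have := ENNReal.Tendsto.const_mul (a := (K : ENNReal))
      (hv0.add (tendsto_finsetSum Finset.univ fun j _ => hd0 j)) (Or.inr ENNReal.coe_ne_top)
    simpa using this
  have hsub : ∀ k l, eLpNorm (v k - v l) 2 (surfaceMeasure Ω) ≤ B k + B l := by
    intro k l
    refine (hK _ ((hvC k).sub (hvC l))).trans ?_
    rw [hB, ← mul_add]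
    gcongr (K : ENNReal) * ?_
    have htri : ∀ (a b c : E3 → ℝ), AEStronglyMeasurable a (volume.restrict Ω) →
        AEStronglyMeasurable b (volume.restrict Ω) → AEStronglyMeasurable c (volume.restrict Ω) →
        eLpNorm (fun x => a x - b x) 2 (volume.restrict Ω) ≤
          eLpNorm (fun x => a x - c x) 2 (volume.restrict Ω) +
          eLpNorm (fun x => b x - c x) 2 (volume.restrict Ω) := by
      intro a b c ha hb hc
      have := eLpNorm_sub_le (ha.sub hc) (hb.sub hc) (p := 2) (by norm_num)
      refine le_trans (le_of_eq (congrArg (fun f => eLpNorm f 2 (volume.restrict Ω)) ?_)) this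
      ext x
      simp
    have h1 := htri (v k) (v l) w (hvC k).continuous.aestronglyMeasurable
      (hvC l).continuous.aestronglyMeasurable hw.memLp.1
    have h2 : ∀ j : Fin 3, eLpNorm (fun x => fderiv ℝ (fun x => v k x - v l x) x
        (EuclideanSpace.single j 1)) 2 (volume.restrict Ω) ≤ _ := fun j => by
      have := htri (fun x => fderiv ℝ (v k) x (EuclideanSpace.single j 1))
        (fun x => fderiv ℝ (v l) x (EuclideanSpace.single j 1)) (G j)
        (continuous_fderiv_apply (hvC k) _).aestronglyMeasurable
        (continuous_fderiv_apply (hvC l) _).aestronglyMeasurable (hw.memLp_grad j).1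
      refine le_trans (le_of_eq (congrArg (fun f => eLpNorm f 2 (volume.restrict Ω)) ?_)) this
      ext x
      rw [fderiv_fun_sub ((hvC k).differentiable (by simp) x)
        ((hvC l).differentiable (by simp) x)]
      rfl
    refine (add_le_add h1 (Finset.sum_le_sum fun j _ => h2 j)).trans_eq ?_
    rw [Finset.sum_add_distrib]
    abel
  have hcauchy : CauchySeq fun k => (hvS k).toLp (v k) := by
    rw [EMetric.cauchySeq_iff]
    intro ε hε
    obtain ⟨N, hN⟩ := eventually_atTop.1
      (hB0.eventually (gt_mem_nhds (ENNReal.half_pos hε.ne')))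
    refine ⟨N, fun m hm n hn => ?_⟩
    rw [Lp.edist_toLp_toLp]
    calc _ ≤ B m + B n := hsub m n
      _ < ε / 2 + ε / 2 := ENNReal.add_lt_add (hN m hm) (hN n hn)
      _ = ε := ENNReal.add_halves ε
  obtain ⟨g, hg⟩ := cauchySeq_tendsto_of_complete hcauchy
  refine ⟨v, g, hvC, hv0, hd0, Lp.memLp g, ?_⟩
  have h1 := tendsto_iff_edist_tendsto_0.1 hg
  refine h1.congr fun k => ?_
  rw [Lp.edist_def]
  refine eLpNorm_congr_ae ?_
  filter_upwards [(hvS k).coeFn_toLp] with x hx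
  rw [Pi.sub_apply, hx]

theorem eLpNorm_le_sum_components (μ : Measure E3) {f : E3 → E3}
    (hf : ∀ i, AEStronglyMeasurable (fun x => f x i) μ) :
    eLpNorm f 2 μ ≤ ∑ i, eLpNorm (fun x => f x i) 2 μ := by
  have h1 : ∀ x, ‖f x‖ ≤ ∑ i, ‖f x i‖ := fun x => by
    rw [EuclideanSpace.norm_eq]
    refine Real.sqrt_le_iff.2 ⟨by positivity, ?_⟩
    exact Finset.sum_sq_le_sq_sum_of_nonneg fun i _ => norm_nonneg _
  have h2 : eLpNorm f 2 μ ≤ eLpNorm (∑ i, fun x => ‖f x i‖) 2 μ := by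
    refine eLpNorm_mono_real fun x => ?_
    simpa using h1 x
  refine h2.trans ((eLpNorm_sum_le (fun i _ => (hf i).norm) (by norm_num)).trans_eq ?_)
  refine Finset.sum_congr rfl fun i _ => eLpNorm_norm _

theorem memLp_component {μ : Measure E3} {f : E3 → E3} (hf : MemLp f 2 μ) (i : Fin 3) :
    MemLp (fun x => f x i) 2 μ :=
  hf.of_le ((EuclideanSpace.proj i : E3 →L[ℝ] ℝ).continuous.comp_aestronglyMeasurable hf.1)
    (Eventually.of_forall fun x => PiLp.norm_apply_le (f x) i)

theorem eLpNorm_component_le (μ : Measure E3) (f : E3 → E3) (i : Fin 3) :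
    eLpNorm (fun x => f x i) 2 μ ≤ eLpNorm f 2 μ :=
  eLpNorm_mono fun x => PiLp.norm_apply_le (f x) i

theorem jacobian_apply {v : E3 → E3} {x : E3} (hv : DifferentiableAt ℝ v x) (i j : Fin 3) :
    jacobian v x i j = fderiv ℝ (fun y => v y i) x (EuclideanSpace.single j 1) := by
  have := ((EuclideanSpace.proj i : E3 →L[ℝ] ℝ).hasFDerivAt.comp x hv.hasFDerivAt).fderiv
  have h2 : fderiv ℝ (fun y => v y i) x =
    (EuclideanSpace.proj i : E3 →L[ℝ] ℝ).comp (fderiv ℝ v x) := this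
  rw [h2]
  rfl

theorem MemH1.isWeakJacobian {u : E3 → E3} (hu : MemH1 Ω u) :
    IsWeakJacobian Ω u (weakJacobian Ω u) := by
  rw [weakJacobian, dif_pos hu.2]
  exact hu.2.choose_spec

theorem MemH1.isWeakGradient {u : E3 → E3} (hu : MemH1 Ω u) (i : Fin 3) :
    IsWeakGradient Ω (fun x => u x i) fun j x => weakJacobian Ω u x i j where
  memLp := memLp_component hu.1 i
  memLp_grad := fun j => hu.isWeakJacobian.1 i j
  integral_eq := fun φ h1 h2 h3 j => hu.isWeakJacobian.2 φ h1 h2 h3 i j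

theorem MemH1.exists_isTrace (hΩ : IsSmoothBoundedDomain Ω) {u : E3 → E3} (hu : MemH1 Ω u) :
    ∃ g, IsTrace Ω u g := by
  choose v g hvC hv hdv hg hvg using fun i => (hu.isWeakGradient i).exists_trace hΩ
  have hVC : ∀ k, ContDiff ℝ ∞ fun x => (WithLp.toLp 2 fun i => v i k x : E3) := fun k =>
    contDiff_euclidean.2 fun i => hvC i k
  refine ⟨fun x => WithLp.toLp 2 fun i => g i x, ?_, fun k x => WithLp.toLp 2 fun i => v i k x,
    hVC, ?_, ?_, ?_⟩
  · refine ⟨?_, ?_⟩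
    · have : AEMeasurable (fun x => fun i => g i x) (surfaceMeasure Ω) :=
        aemeasurable_pi_lambda _ fun i => (hg i).1.aemeasurable
      exact ((WithLp.measurable_toLp 2 _).comp_aemeasurable this).aestronglyMeasurable
    · refine (eLpNorm_le_sum_components _ fun i => (hg i).1).trans_lt ?_
      exact ENNReal.sum_lt_top.2 fun i _ => (hg i).2
  · refine tendsto_of_tendsto_of_tendsto_of_le_of_le tendsto_const_nhds
      (by simpa using tendsto_finsetSum Finset.univ fun i _ => hv i) (fun _ => zero_le)
      fun k => ?_
    exact eLpNorm_le_sum_components _ fun i =>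
      (hvC i k).continuous.aestronglyMeasurable.sub (memLp_component hu.1 i).1
  · intro i j
    refine (hdv i j).congr fun k => ?_
    congr 1
    ext x
    rw [jacobian_apply ((hVC k).differentiable (by simp) x)]
  · refine tendsto_of_tendsto_of_tendsto_of_le_of_le tendsto_const_nhds
      (by simpa using tendsto_finsetSum Finset.univ fun i _ => hvg i) (fun _ => zero_le)
      fun k => ?_
    exact eLpNorm_le_sum_components _ fun i =>
      (hvC i k).continuous.aestronglyMeasurable.sub (hg i).1

theorem MemH1.isTrace_boundaryTrace (hΩ : IsSmoothBoundedDomain Ω) {u : E3 → E3}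
    (hu : MemH1 Ω u) : IsTrace Ω u (boundaryTrace Ω u) := by
  have h := hu.exists_isTrace hΩ
  rw [boundaryTrace, dif_pos h]
  exact h.choose_spec

/-! ### Green's formula for traces -/

theorem tendsto_integral_mul_of_eLpNorm {μ : Measure E3} {h f : E3 → ℝ} {F : ℕ → E3 → ℝ}
    (hh : MemLp h 2 μ) (hf : MemLp f 2 μ) (hF : ∀ k, MemLp (F k) 2 μ)
    (hlim : Tendsto (fun k => eLpNorm (fun x => F k x - f x) 2 μ) atTop (𝓝 0)) :
    Tendsto (fun k => ∫ x, h x * F k x ∂μ) atTop (𝓝 (∫ x, h x * f x ∂μ)) := by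
  rw [tendsto_iff_edist_tendsto_0]
  have hb : Tendsto (fun k => eLpNorm h 2 μ * eLpNorm (fun x => F k x - f x) 2 μ) atTop (𝓝 0) := by
    simpa using ENNReal.Tendsto.const_mul hlim (Or.inr hh.2.ne)
  refine tendsto_of_tendsto_of_tendsto_of_le_of_le tendsto_const_nhds hb (fun _ => zero_le)
    fun k => ?_
  have i1 : Integrable (fun x => h x * F k x) μ := hh.integrable_mul (hF k)
  have i2 : Integrable (fun x => h x * f x) μ := hh.integrable_mul hf
  rw [edist_eq_enorm_sub, ← integral_sub i1 i2]
  refine (enorm_integral_le_lintegral_enorm _).trans ?_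
  have := eLpNorm_smul_le_mul_eLpNorm (p := 2) (q := 2) (r := 1) ((hF k).sub hf).1 hh.1
  rw [eLpNorm_one_eq_lintegral_enorm] at this
  refine le_trans (le_of_eq ?_) this
  refine lintegral_congr fun x => ?_
  simp [mul_sub]

theorem IsSmoothBoundedDomain.integral_mul_fderiv (hΩ : IsSmoothBoundedDomain Ω) {h v : E3 → ℝ}
    (hh : ContDiff ℝ ∞ h) (hv : ContDiff ℝ ∞ v) (j : Fin 3) :
    ∫ x in Ω, h x * fderiv ℝ v x (EuclideanSpace.single j 1) =
      (∫ x, h x * outwardNormal Ω x j * v x ∂(surfaceMeasure Ω)) -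
        ∫ x in Ω, fderiv ℝ h x (EuclideanSpace.single j 1) * v x := by
  have h1 := hΩ.integral_fderiv (hh.mul hv) (EuclideanSpace.single j 1)
  have h2 : ∀ x, fderiv ℝ (fun x => h x * v x) x (EuclideanSpace.single j 1) =
      h x * fderiv ℝ v x (EuclideanSpace.single j 1) +
        fderiv ℝ h x (EuclideanSpace.single j 1) * v x := fun x => by
    rw [fderiv_fun_mul (hh.differentiable (by simp) x) (hv.differentiable (by simp) x)]
    simp [mul_comm]
  simp only [h2, inner_single_one] at h1
  have i1 : IntegrableOn (fun x => h x * fderiv ℝ v x (EuclideanSpace.single j 1)) Ω :=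
    hΩ.integrableOn (hh.continuous.mul (continuous_fderiv_apply hv _))
  have i2 : IntegrableOn (fun x => fderiv ℝ h x (EuclideanSpace.single j 1) * v x) Ω :=
    hΩ.integrableOn ((continuous_fderiv_apply hh _).mul hv.continuous)
  rw [integral_add i1 i2] at h1
  rw [eq_sub_iff_add_eq, h1]
  refine integral_congr_ae (Eventually.of_forall fun x => ?_)
  simp only
  ring

theorem IsSmoothBoundedDomain.continuousOn_outwardNormal_apply (hΩ : IsSmoothBoundedDomain Ω)
    (j : Fin 3) : ContinuousOn (fun x => outwardNormal Ω x j) (frontier Ω) :=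
  (EuclideanSpace.proj j : E3 →L[ℝ] ℝ).continuous.comp_continuousOn hΩ.continuousOn_outwardNormal

/-- Green's formula for a field in `H¹(Ω)` and its trace. -/
theorem IsTrace.integral_mul_weakJacobian (hΩ : IsSmoothBoundedDomain Ω) {u g : E3 → E3}
    (hu : MemH1 Ω u) (hg : IsTrace Ω u g) {h : E3 → ℝ} (hh : ContDiff ℝ ∞ h) (i j : Fin 3) :
    ∫ x in Ω, h x * weakJacobian Ω u x i j =
      (∫ x, h x * outwardNormal Ω x j * g x i ∂(surfaceMeasure Ω)) -
        ∫ x in Ω, fderiv ℝ h x (EuclideanSpace.single j 1) * u x i := by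
  obtain ⟨hgL, v, hvC, hv, hdv, hvg⟩ := hg
  have hvi : ∀ k, ContDiff ℝ ∞ fun x => v k x i := fun k => contDiff_euclidean.1 (hvC k) i
  -- A single sequence in the definition of the trace converges in `Ω`, together with its gradient,
  -- and on the boundary, so each term of the smooth formula passes to the limit.
  have h1 : Tendsto (fun k => ∫ x in Ω, h x * fderiv ℝ (fun y => v k y i) x
      (EuclideanSpace.single j 1)) atTop (𝓝 (∫ x in Ω, h x * weakJacobian Ω u x i j)) := by
    refine tendsto_integral_mul_of_eLpNorm (hΩ.memLp_of_continuous hh.continuous)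
      (hu.isWeakJacobian.1 i j) (fun k => hΩ.memLp_of_continuous (continuous_fderiv_apply (hvi k) _))
      ((hdv i j).congr fun k => ?_)
    congr 1
    ext x
    rw [jacobian_apply ((hvC k).differentiable (by simp) x)]
  have hcomp : ∀ (μ : Measure E3) (f : E3 → E3),
      Tendsto (fun k => eLpNorm (v k - f) 2 μ) atTop (𝓝 0) →
      Tendsto (fun k => eLpNorm (fun x => v k x i - f x i) 2 μ) atTop (𝓝 0) := fun μ f hl =>
    tendsto_of_tendsto_of_tendsto_of_le_of_le tendsto_const_nhds hl (fun _ => zero_le)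
      fun k => eLpNorm_component_le μ (v k - f) i
  have hhn : ContinuousOn (fun x => h x * outwardNormal Ω x j) (frontier Ω) :=
    hh.continuous.continuousOn.mul (hΩ.continuousOn_outwardNormal_apply j)
  have h2 : Tendsto (fun k => ∫ x, h x * outwardNormal Ω x j * v k x i ∂(surfaceMeasure Ω)) atTop
      (𝓝 (∫ x, h x * outwardNormal Ω x j * g x i ∂(surfaceMeasure Ω))) :=
    tendsto_integral_mul_of_eLpNorm (hΩ.memLp_surfaceMeasure hhn)
      (memLp_component hgL i) (fun k => hΩ.memLp_surfaceMeasure (hvi k).continuous.continuousOn)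
      (hcomp _ _ hvg)
  have h3 : Tendsto (fun k => ∫ x in Ω, fderiv ℝ h x (EuclideanSpace.single j 1) * v k x i) atTop
      (𝓝 (∫ x in Ω, fderiv ℝ h x (EuclideanSpace.single j 1) * u x i)) :=
    tendsto_integral_mul_of_eLpNorm (hΩ.memLp_of_continuous (continuous_fderiv_apply hh _))
      (memLp_component hu.1 i) (fun k => hΩ.memLp_of_continuous (hvi k).continuous) (hcomp _ _ hv)
  refine tendsto_nhds_unique h1 ((h2.sub h3).congr fun k => ?_)
  exact (hΩ.integral_mul_fderiv hh (hvi k) j).symm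

end

/-! ### Solenoidal tangential fields and the transposed gradient. -/

section

variable {Ω : Set E3} {p : E3}

theorem gradient_apply (φ : E3 → ℝ) (x : E3) (i : Fin 3) :
    gradient φ x i = fderiv ℝ φ x (EuclideanSpace.single i 1) := by
  rw [fderiv_apply_eq_inner_gradient, real_inner_comm, inner_single_one]

theorem integral_inner_gradient (hΩ : IsSmoothBoundedDomain Ω) {u : E3 → E3}
    (hu : MemLp u 2 (volume.restrict Ω)) {φ : E3 → ℝ} (hφ : ContDiff ℝ ∞ φ) :
    ∫ x in Ω, inner ℝ (u x) (gradient φ x) =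
      ∑ i, ∫ x in Ω, fderiv ℝ φ x (EuclideanSpace.single i 1) * u x i := by
  rw [← integral_finsetSum]
  · refine integral_congr_ae (Eventually.of_forall fun x => ?_)
    simp only [inner_eq_sum, gradient_apply]
    exact Finset.sum_congr rfl fun i _ => mul_comm _ _
  · exact fun i _ => integrable_mul_continuous hΩ (memLp_component hu i)
      (continuous_fderiv_apply hφ _)

/-- Summing the definition of weak partial derivatives over the diagonal turns weak solenoidality
into orthogonality of the trace of `Du` to all test functions in `Ω`. -/
theorem MemH1SigmaTan.ae_trace_weakJacobian (hΩ : IsSmoothBoundedDomain Ω) {u : E3 → E3}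
    (hu : MemH1SigmaTan Ω u) :
    ∀ᵐ x ∂(volume.restrict Ω), ∑ i, weakJacobian Ω u x i i = 0 := by
  have hfin := hΩ.isFiniteMeasure_volume
  have hG := hu.2.isWeakJacobian
  have hint : Integrable (fun x => ∑ i, weakJacobian Ω u x i i) (volume.restrict Ω) :=
    integrable_finsetSum _ fun i _ => (hG.1 i i).integrable (by norm_num)
  rw [ae_restrict_iff' hΩ.isOpen.measurableSet]
  refine hΩ.isOpen.ae_eq_zero_of_integral_contDiff_smul_eq_zero
    (IntegrableOn.locallyIntegrableOn hint) fun φ hφ hc hs => ?_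
  have h1 : ∫ x, φ x • ∑ i, weakJacobian Ω u x i i =
      ∫ x in Ω, φ x • ∑ i, weakJacobian Ω u x i i := by
    refine (setIntegral_eq_integral_of_forall_compl_eq_zero fun x hx => ?_).symm
    rw [image_eq_zero_of_notMem_tsupport fun h => hx (hs h), zero_smul]
  have h2 := hu.1.solenoidal φ hφ hc hs
  rw [integral_inner_gradient hΩ hu.1.memLp hφ] at h2
  have h3 : ∀ i : Fin 3, ∫ x in Ω, fderiv ℝ φ x (EuclideanSpace.single i 1) * u x i =
      - ∫ x in Ω, φ x * weakJacobian Ω u x i i := fun i => by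
    have := hG.2 φ hφ hc hs i i
    simp only [mul_comm (u _ _), mul_comm (weakJacobian _ _ _ _ _)] at this
    exact this
  rw [Finset.sum_congr rfl fun i _ => h3 i, Finset.sum_neg_distrib, neg_eq_zero] at h2
  rw [h1, ← h2, ← integral_finsetSum]
  · simp only [smul_eq_mul, Finset.mul_sum]
  · exact fun i _ => integrable_mul_continuous hΩ (hG.1 i i) hφ.continuous

/-- The trace of a field in `H¹_{σ,tan}(Ω)` is tangent to the boundary. -/
theorem MemH1SigmaTan.ae_inner_trace (hΩ : IsSmoothBoundedDomain Ω) {u g : E3 → E3}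
    (hu : MemH1SigmaTan Ω u) (hg : IsTrace Ω u g) :
    ∀ᵐ x ∂(surfaceMeasure Ω), inner ℝ (g x) (outwardNormal Ω x) = 0 := by
  have hfin := hΩ.isFiniteMeasure_surfaceMeasure
  have hint : ∀ f : E3 → ℝ, Continuous f → ∀ i, Integrable
      (fun x => f x * outwardNormal Ω x i * g x i) (surfaceMeasure Ω) := fun f hf i => by
    have hc : ContinuousOn (fun x => f x * outwardNormal Ω x i) (frontier Ω) :=
      hf.continuousOn.mul (hΩ.continuousOn_outwardNormal_apply i)
    exact (hΩ.memLp_surfaceMeasure hc).integrable_mul (memLp_component hg.1 i)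
  have hexp : ∀ x, inner ℝ (g x) (outwardNormal Ω x) =
      ∑ i, 1 * outwardNormal Ω x i * g x i := fun x => by
    rw [inner_eq_sum]
    exact Finset.sum_congr rfl fun i _ => by ring
  -- The test functions live on the whole space and need not vanish on the boundary. For each,
  -- Green's formula summed over `i = j` equates the boundary integral with `∫ u · ∇φ`, which the
  -- weak tangency condition makes zero.
  refine ae_eq_zero_of_integral_contDiff_smul_eq_zero (Integrable.locallyIntegrable ?_)
    fun φ hφ hc => ?_
  · simp only [hexp]
    exact integrable_finsetSum _ fun i _ => hint _ continuous_const i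
  have h1 : ∫ x, φ x • inner ℝ (g x) (outwardNormal Ω x) ∂(surfaceMeasure Ω) =
      ∑ i, ∫ x, φ x * outwardNormal Ω x i * g x i ∂(surfaceMeasure Ω) := by
    rw [← integral_finsetSum _ fun i _ => hint φ hφ.continuous i]
    refine integral_congr_ae (Eventually.of_forall fun x => ?_)
    simp only [hexp, smul_eq_mul, Finset.mul_sum]
    exact Finset.sum_congr rfl fun i _ => by ring
  have h2 : ∑ i, ∫ x in Ω, φ x * weakJacobian Ω u x i i = 0 := by
    rw [← integral_finsetSum _ fun i _ => integrable_mul_continuous hΩ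
      (hu.2.isWeakJacobian.1 i i) hφ.continuous]
    refine integral_eq_zero_of_ae ?_
    filter_upwards [hu.ae_trace_weakJacobian hΩ] with x hx
    rw [← Finset.mul_sum, hx, mul_zero]; rfl
  have h3 := hu.1.tangent φ hφ
  rw [integral_inner_gradient hΩ hu.1.memLp hφ] at h3
  rw [Finset.sum_congr rfl fun i _ => hg.integral_mul_weakJacobian hΩ hu.2 hφ i i,
    Finset.sum_sub_distrib, h3, sub_zero] at h2
  rw [h1, h2]

theorem fderiv_fderiv_comm {f : E3 → ℝ} (hf : ContDiff ℝ ∞ f) (x a b : E3) :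
    fderiv ℝ (fun y => fderiv ℝ f y a) x b = fderiv ℝ (fun y => fderiv ℝ f y b) x a := by
  have hd : DifferentiableAt ℝ (fderiv ℝ f) x :=
    (hf.fderiv_right (m := ∞) (by simp)).differentiable (by simp) x
  have hs : IsSymmSndFDerivAt ℝ f x := hf.contDiffAt.isSymmSndFDerivAt (by
    simpa using WithTop.coe_le_coe.2 (le_top : (2 : ℕ∞) ≤ ⊤))
  have h1 : ∀ c : E3, fderiv ℝ (fun y => fderiv ℝ f y c) x = (fderiv ℝ (fderiv ℝ f) x).flip c :=
    fun c => by
      rw [fderiv_clm_apply hd (differentiableAt_const c)]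
      simp
  rw [h1, h1]
  exact hs b a

theorem inner_fderiv_eq_sum {Ψ : E3 → E3} {x : E3} (hΨ : DifferentiableAt ℝ Ψ x) (w n : E3) :
    inner ℝ (fderiv ℝ Ψ x w) n =
      ∑ i, ∑ j, fderiv ℝ (fun y => Ψ y j) x (EuclideanSpace.single i 1) * n j * w i := by
  have hexp : ∀ j, fderiv ℝ Ψ x w j =
      ∑ i, w i * fderiv ℝ (fun y => Ψ y j) x (EuclideanSpace.single i 1) := fun j => by
    have hw : w = ∑ i, w i • (EuclideanSpace.single i 1 : E3) := by
      simpa using ((EuclideanSpace.basisFun (Fin 3) ℝ).sum_repr w).symm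
    conv_lhs => rw [hw, map_sum]
    simp only [map_smul, WithLp.ofLp_sum, Finset.sum_apply, PiLp.smul_apply, smul_eq_mul,
      ← jacobian_apply hΨ]
    rfl
  simp only [inner_eq_sum, hexp]
  rw [Finset.sum_comm]
  refine Finset.sum_congr rfl fun j _ => ?_
  rw [Finset.sum_mul]
  exact Finset.sum_congr rfl fun i _ => by ring

theorem integrable_fderiv_mul_normal (hΩ : IsSmoothBoundedDomain Ω) {Ψ g : E3 → E3}
    (hΨ : ContDiff ℝ ∞ Ψ) (hg : MemLp g 2 (surfaceMeasure Ω)) (i j : Fin 3) :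
    Integrable (fun x => fderiv ℝ (fun y => Ψ y j) x (EuclideanSpace.single i 1) *
      outwardNormal Ω x j * g x i) (surfaceMeasure Ω) := by
  have hc : ContinuousOn (fun x => fderiv ℝ (fun y => Ψ y j) x (EuclideanSpace.single i 1) *
      outwardNormal Ω x j) (frontier Ω) :=
    (continuous_fderiv_apply (contDiff_euclidean.1 hΨ j) _).continuousOn.mul
      (hΩ.continuousOn_outwardNormal_apply j)
  exact (hΩ.memLp_surfaceMeasure hc).integrable_mul (memLp_component hg i)

theorem integrable_inner_fderiv_normal (hΩ : IsSmoothBoundedDomain Ω) {Ψ g : E3 → E3}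
    (hΨ : ContDiff ℝ ∞ Ψ) (hg : MemLp g 2 (surfaceMeasure Ω)) :
    Integrable (fun x => inner ℝ (fderiv ℝ Ψ x (g x)) (outwardNormal Ω x)) (surfaceMeasure Ω) := by
  simp only [inner_fderiv_eq_sum (hΨ.differentiable (by simp) _)]
  exact integrable_finsetSum _ fun i _ => integrable_finsetSum _ fun j _ =>
    integrable_fderiv_mul_normal hΩ hΨ hg i j

/-- For a divergence-free smooth field, the transposed gradients pair to a boundary integral. -/
theorem IsTrace.integral_transpose_jacobian (hΩ : IsSmoothBoundedDomain Ω) {u g : E3 → E3}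
    (hu : MemH1 Ω u) (hg : IsTrace Ω u g) {Ψ : E3 → E3} (hΨ : ContDiff ℝ ∞ Ψ)
    (hdiv : ∀ x ∈ Ω, (jacobian Ψ x).trace = 0) :
    ∫ x in Ω, frobenius (jacobian Ψ x).transpose (weakJacobian Ω u x) =
      ∫ x, inner ℝ (fderiv ℝ Ψ x (g x)) (outwardNormal Ω x) ∂(surfaceMeasure Ω) := by
  have hΨj : ∀ j, ContDiff ℝ ∞ fun x => Ψ x j := fun j => contDiff_euclidean.1 hΨ j
  have hΨd : ∀ x, DifferentiableAt ℝ Ψ x := fun x => hΨ.differentiable (by simp) x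
  set h : Fin 3 → Fin 3 → E3 → ℝ := fun i j x =>
    fderiv ℝ (fun y => Ψ y j) x (EuclideanSpace.single i 1) with hh
  have hhC : ∀ i j, ContDiff ℝ ∞ (h i j) := fun i j =>
    ((hΨj j).fderiv_right (m := ∞) (by simp)).clm_apply contDiff_const
  have hleft : ∫ x in Ω, frobenius (jacobian Ψ x).transpose (weakJacobian Ω u x) =
      ∑ i, ∑ j, ∫ x in Ω, h i j x * weakJacobian Ω u x i j := by
    have hint : ∀ i j, Integrable (fun x => h i j x * weakJacobian Ω u x i j)
        (volume.restrict Ω) := fun i j =>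
      integrable_mul_continuous hΩ (hu.isWeakJacobian.1 i j) (hhC i j).continuous
    simp only [← integral_finsetSum _ fun j _ => hint _ j]
    rw [← integral_finsetSum _ fun i _ => integrable_finsetSum _ fun j _ => hint i j]
    simp only [frobenius, Matrix.transpose_apply, jacobian_apply (hΨd _), hh]
  have hright : ∫ x, inner ℝ (fderiv ℝ Ψ x (g x)) (outwardNormal Ω x) ∂(surfaceMeasure Ω) =
      ∑ i, ∑ j, ∫ x, h i j x * outwardNormal Ω x j * g x i ∂(surfaceMeasure Ω) := by
    have hint : ∀ i j, Integrable (fun x => h i j x * outwardNormal Ω x j * g x i)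
        (surfaceMeasure Ω) := integrable_fderiv_mul_normal hΩ hΨ hg.1
    simp only [← integral_finsetSum _ fun j _ => hint _ j]
    rw [← integral_finsetSum _ fun i _ => integrable_finsetSum _ fun j _ => hint i j]
    exact integral_congr_ae (Eventually.of_forall fun x => inner_fderiv_eq_sum (hΨd x) _ _)
  -- The volume remainder of the integration by parts is `∂ᵢ(div Ψ) uᵢ` after exchanging second
  -- derivatives; it vanishes since `div Ψ = 0` near each point of the open set `Ω`.
  have hzero : ∑ i, ∑ j, ∫ x in Ω, fderiv ℝ (h i j) x (EuclideanSpace.single j 1) * u x i = 0 := by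
    refine Finset.sum_eq_zero fun i _ => ?_
    rw [← integral_finsetSum _ fun j _ => integrable_mul_continuous hΩ (memLp_component hu.1 i)
      (continuous_fderiv_apply (hhC i j) _)]
    refine setIntegral_eq_zero_of_forall_eq_zero fun x hx => ?_
    have hd0 : ∑ j, fderiv ℝ (h i j) x (EuclideanSpace.single j 1) = 0 := by
      have heq : (fun y => ∑ j, h j j y) =ᶠ[𝓝 x] fun _ => (0 : ℝ) := by
        filter_upwards [hΩ.isOpen.mem_nhds hx] with y hy
        rw [← hdiv y hy, Matrix.trace]
        simp only [Matrix.diag_apply, jacobian_apply (hΨd y), hh]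
      have h1 := heq.fderiv_eq (𝕜 := ℝ)
      rw [fderiv_fun_sum fun j _ => (hhC j j).differentiable (by simp) x, fderiv_fun_const] at h1
      have h2 := congrArg (fun L : E3 →L[ℝ] ℝ => L (EuclideanSpace.single i 1)) h1
      simp only [sum_apply, Pi.zero_apply, zero_apply] at h2
      rw [← h2]
      exact Finset.sum_congr rfl fun j _ => fderiv_fderiv_comm (hΨj j) x _ _
    rw [← Finset.sum_mul, hd0, zero_mul]
  rw [hleft, hright]
  simp only [hg.integral_mul_weakJacobian hΩ hu (hhC _ _), Finset.sum_sub_distrib, hzero, sub_zero]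

theorem two_mul_frobenius_symPart (A B : Matrix (Fin 3) (Fin 3) ℝ) :
    2 * frobenius (symPart A) (symPart B) = frobenius A B + frobenius A.transpose B := by
  simp only [frobenius, symPart, Fin.sum_univ_three, Matrix.smul_apply, Matrix.add_apply,
    Matrix.transpose_apply, smul_eq_mul]
  ring

theorem integrable_frobenius (hΩ : IsSmoothBoundedDomain Ω) {A G : E3 → Matrix (Fin 3) (Fin 3) ℝ}
    (hA : ∀ i j, Continuous fun x => A x i j)
    (hG : ∀ i j, MemLp (fun x => G x i j) 2 (volume.restrict Ω)) :
    Integrable (fun x => frobenius (A x) (G x)) (volume.restrict Ω) :=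
  integrable_finsetSum _ fun i _ => integrable_finsetSum _ fun j _ =>
    integrable_mul_continuous hΩ (hG i j) (hA i j)

end

end NavierFriction

end



/-! ### The identity. -/

theorem proposition4p3 (Ω : Set E3) (hΩ : IsSmoothBoundedDomain Ω)
    (α : E3 → ℝ) (hα : ContinuousOn α (frontier Ω))
    (u : E3 → E3) (hu : MemH1SigmaTan Ω u)
    (Φ : E3 → E3) (hΦ : MemSmoothSigmaTan Ω Φ) :
    (∫ x in Ω, frobenius (jacobian Φ x) (weakJacobian Ω u x)) +
        ∫ p, inner ℝ (Φ p)
          (α p • boundaryTrace Ω u p - shapeOperator Ω p (boundaryTrace Ω u p))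
          ∂(surfaceMeasure Ω) =
      2 * (∫ x in Ω, frobenius (symPart (jacobian Φ x)) (symPart (weakJacobian Ω u x))) +
        ∫ p, α p * inner ℝ (Φ p) (boundaryTrace Ω u p) ∂(surfaceMeasure Ω) := by
  obtain ⟨Ψ, hΨ, hΦΨ⟩ := hΦ.smooth
  have hΩm : MeasurableSet Ω := hΩ.isOpen.measurableSet
  have hSm : MeasurableSet (frontier Ω) := isClosed_frontier.measurableSet
  have hΨd : ∀ x, DifferentiableAt ℝ Ψ x := fun x => hΨ.differentiable (by simp) x
  have hfr : Set.EqOn Φ Ψ (frontier Ω) := hΦΨ.mono frontier_subset_closure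
  -- `Φ` is prescribed only on the closure, so its derivative at boundary points may be meaningless.
  -- Derivatives of `Φ` are replaced by those of the smooth extension `Ψ`.
  have hjac : ∀ x ∈ Ω, jacobian Φ x = jacobian Ψ x := fun x hx => by
    have : Φ =ᶠ[𝓝 x] Ψ := by
      filter_upwards [hΩ.isOpen.mem_nhds hx] with y hy using hΦΨ (subset_closure hy)
    rw [jacobian, jacobian, this.fderiv_eq]
  set G := weakJacobian Ω u with hG
  set g := boundaryTrace Ω u with hgdef
  have hg : IsTrace Ω u g := hu.2.isTrace_boundaryTrace hΩ
  have hGL := hu.2.isWeakJacobian.1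
  have hJc : ∀ i j, Continuous fun x => jacobian Ψ x i j := fun i j => by
    simp only [jacobian_apply (hΨd _)]
    exact continuous_fderiv_apply (contDiff_euclidean.1 hΨ i) _
  have hI1 := integrable_frobenius hΩ hJc hGL
  have hI2 := integrable_frobenius hΩ (A := fun x => (jacobian Ψ x).transpose)
    (fun i j => hJc j i) hGL
  have hvol1 : ∫ x in Ω, frobenius (jacobian Φ x) (G x) =
      ∫ x in Ω, frobenius (jacobian Ψ x) (G x) :=
    setIntegral_congr_fun hΩm fun x hx => by simp only [hjac x hx]
  have hvol2 : 2 * ∫ x in Ω, frobenius (symPart (jacobian Φ x)) (symPart (G x)) =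
      (∫ x in Ω, frobenius (jacobian Ψ x) (G x)) +
        ∫ x in Ω, frobenius (jacobian Ψ x).transpose (G x) := by
    rw [← integral_const_mul, ← integral_add hI1 hI2]
    refine setIntegral_congr_fun hΩm fun x hx => ?_
    simp only [hjac x hx, two_mul_frobenius_symPart, hG]
  have hdiv : ∀ x ∈ Ω, (jacobian Ψ x).trace = 0 := fun x hx => by
    rw [← hjac x hx]; exact hΦ.solenoidal x hx
  have hkey := hg.integral_transpose_jacobian hΩ hu.2 hΨ hdiv
  have htan : ∀ q ∈ frontier Ω, inner ℝ (Ψ q) (outwardNormal Ω q) = 0 := fun q hq => by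
    rw [← hfr hq]; exact hΦ.tangent q hq
  -- Only almost everywhere, because the trace is tangent only up to a null set.
  have hshape : ∀ᵐ x ∂(surfaceMeasure Ω), inner ℝ (Φ x) (shapeOperator Ω x (g x)) =
      - inner ℝ (fderiv ℝ Ψ x (g x)) (outwardNormal Ω x) := by
    filter_upwards [hu.ae_inner_trace hΩ hg, ae_restrict_mem hSm] with x hx hxf
    rw [hfr hxf]
    exact hΩ.inner_shapeOperator hxf (hΨd x) htan hx
  -- Integrability of both boundary terms is needed to split the integral.
  have hJS : Integrable (fun x => α x * inner ℝ (Φ x) (g x)) (surfaceMeasure Ω) := by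
    have h1 : Integrable (fun x => ∑ i, α x * Ψ x i * g x i) (surfaceMeasure Ω) := by
      refine integrable_finsetSum _ fun i _ => ?_
      have hc : ContinuousOn (fun x => α x * Ψ x i) (frontier Ω) :=
        hα.mul (contDiff_euclidean.1 hΨ i).continuous.continuousOn
      exact (hΩ.memLp_surfaceMeasure hc).integrable_mul (memLp_component hg.1 i)
    refine h1.congr ((ae_restrict_mem hSm).mono fun x hx => ?_)
    simp only [hfr hx, inner_eq_sum, Finset.mul_sum, mul_assoc]
  have hKS : Integrable (fun x => inner ℝ (fderiv ℝ Ψ x (g x)) (outwardNormal Ω x))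
      (surfaceMeasure Ω) := integrable_inner_fderiv_normal hΩ hΨ hg.1
  have hbd : ∫ x, inner ℝ (Φ x) (α x • g x - shapeOperator Ω x (g x)) ∂(surfaceMeasure Ω) =
      (∫ x, α x * inner ℝ (Φ x) (g x) ∂(surfaceMeasure Ω)) +
        ∫ x, inner ℝ (fderiv ℝ Ψ x (g x)) (outwardNormal Ω x) ∂(surfaceMeasure Ω) := by
    rw [← integral_add hJS hKS]
    refine integral_congr_ae ?_
    filter_upwards [hshape] with x hx
    rw [inner_sub_right, hx, real_inner_smul_right, sub_neg_eq_add]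
  rw [hvol1, hbd, hvol2, hkey]
  ring
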